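/- Let $\alpha=\eta+i\zeta\in\mathbb C$ with $\eta>0$ and $\zeta\neq 0$, and for $n\in\mathbb N$ let $$p_n(z)={}_2F_1(-n,\ \alpha n+1;\ \alpha n+2;\ z).$$ For $z\in\mathbb C\setminus\{0\}$ let $\phi(t)=\log\bigl(t^{\alpha}(1-zt)\bigr)$. Its derivative $\phi'(t)=\dfrac{\alpha-(\alpha+1)zt}{t(1-zt)}$ does not depend on the choice of branches, has poles at $0$ and $1/z$, and its only zero is the saddle point $t_0=\dfrac{\alpha}{(\alpha+1)z}$. The paths of steepest ascent are the trajectories of the gradient field $\overline{\phi'(t)}$ of $\operatorname{Re}\phi$. Let $\delta_z$ be the union of the paths of steepest ascent starting at $t_0$, together with $t_0$ itself; that is, the set of all points $\gamma(0)$, where $\gamma:(-\infty,0]\to\mathbb C\setminus\{0,1/z\}$ satisfies $\gamma'(s)=\overline{\phi'(\gamma(s))}$ and $\gamma(s)\to t_0$ as $s\to-\infty$. Let $D_{1/z}$ be the union of $\delta_z$ and the connected component of $\mathbb C\setminus\delta_z$ that contains $1/z$. Put $$E=\{z\in\mathbb C\setminus\{0\} : 1\in D_{1/z}\}.$$ If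 $z\in\mathbb C$ and $z\notin E$, then $z$ is not a limit of zeros of the polynomials $p_n$: there are no strictly increasing sequence $n_1<n_2<\cdots$ of natural numbers and points $w_j\in\mathbb C$ with $p_{n_j}(w_j)=0$ for all $j$ and $w_j\to z$ as $j\to\infty$. -/

import Mathlib

open Filter Topology

noncomputable section

/-- The hypergeometric polynomial `p_n(z) = ₂F₁(-n, αn + 1; αn + 2; z)`. -/
def hypPoly (α : ℂ) (n : ℕ) (z : ℂ) : ℂ :=
  ordinaryHypergeometric (-(n : ℂ)) (α * n + 1) (α * n + 2) z

/-- The derivative `φ'(t)` of `φ(t) = log (t ^ α (1 - z t))`. It is a single-valued rational function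
of `t`, with poles at `0` and `1 / z`, whatever branches of the logarithm are used for `φ`. -/
def phiDeriv (α z t : ℂ) : ℂ :=
  (α - z * t * (α + 1)) / (t * (1 - z * t))

/-- `phiDeriv` is the derivative of `φ(t) = α log t + log (1 - z t)`. -/
theorem hasDerivAt_phi {α z t : ℂ} (ht : t ∈ Complex.slitPlane)
    (hzt : 1 - z * t ∈ Complex.slitPlane) :
    HasDerivAt (fun u : ℂ => α * Complex.log u + Complex.log (1 - z * u)) (phiDeriv α z t) t := by
  have h0 : t ≠ 0 := Complex.slitPlane_ne_zero ht
  have h1 : 1 - z * t ≠ 0 := Complex.slitPlane_ne_zero hzt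
  have h2 : HasDerivAt (fun u : ℂ => 1 - z * u) (-(z * 1)) t :=
    ((hasDerivAt_id' t).const_mul z).const_sub 1
  have h3 : phiDeriv α z t = α * t⁻¹ + -(z * 1) / (1 - z * t) := by
    unfold phiDeriv
    field_simp
    ring
  rw [h3]
  exact ((Complex.hasDerivAt_log ht).const_mul α).add (h2.clog hzt)

/-- The saddle point `t₀ = α / ((α + 1) z)`, the only zero of `φ'`. -/
def saddlePoint (α z : ℂ) : ℂ := α / ((α + 1) * z)

/-- The union of the paths of steepest ascent that start at the saddle point `t₀` (with `t₀` itself).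
The gradient of `Re φ` at `t`, as a complex number, is the conjugate of `φ'(t)`; so `t` belongs to
this set iff some trajectory of the gradient field of `Re φ`, defined for times `s ≤ 0`, avoids the
poles `0` and `1 / z`, emanates from `t₀` at time `-∞`, and is at `t` at time `0`. -/
def ascentCurves (α z : ℂ) : Set ℂ :=
  {t | ∃ γ : ℝ → ℂ,
    (∀ s ≤ 0, γ s ≠ 0 ∧ γ s ≠ 1 / z ∧
      HasDerivWithinAt γ (starRingEnd ℂ (phiDeriv α z (γ s))) (Set.Iic 0) s) ∧
    Tendsto γ atBot (𝓝 (saddlePoint α z)) ∧ γ 0 = t}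

/-- The closed region `D_p` that contains the point `p`, among those into which the paths of steepest
ascent from the saddle point split the plane: the connected component of `p` in the complement of
these paths, together with the bounding paths themselves. -/
def closedRegion (α z p : ℂ) : Set ℂ :=
  connectedComponentIn (ascentCurves α z)ᶜ p ∪ ascentCurves α z

/-- `E = {z : 1 ∈ D_{1/z}}`; `D_{1/z}` makes sense for `z ≠ 0` only. -/
def regionE (α : ℂ) : Set ℂ :=
  {z | z ≠ 0 ∧ (1 : ℂ) ∈ closedRegion α z (1 / z)}

end

/-!
The polynomial `p_n (w)` is `α n + 1` times the integral over `[0, 1]` of the `n`-th power of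
`t ^ α * (1 - w * t)` (`hypPoly_eq`). The integral may be taken along any path from `1` to `0` on
which `t ^ α` is continued and tends to `0`; the polynomial is a finite sum of elementary integrals,
so this needs no contour deformation (`IsDescentToZero.integral_eq`). If the path of steepest descent
for `z` that starts at `1` leads to `0`, then the integrand for `w` near `z` is largest at `1` and
decreases exponentially along this path, and by Laplace's method the integral, divided by
`(1 - w) ^ n / n`, tends to a nonzero limit as `n → ∞` and `w → z`. So zeros cannot accumulate at `z`
(`IsDescentToZero.not_tendsto_zeros`). For `z = 0` the path is a logarithmic spiral.

It remains to see that for `z ≠ 0` outside `E` the descending path from `1` does lead to `0`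
(`IsDescentFlow.tendsto_zero_of_notMem_regionE`). Multiplied by a positive function, the field of
steepest descent becomes a polynomial field whose equilibria are the poles `0` and `1 / z` and the
saddle point `t₀`, and a descending trajectory converges to one of these points
(`IsDescentFlow.tendsto_or`). If the limit is `t₀`, then `1` lies on a path of steepest ascent from
`t₀`; if it is `1 / z`, then the trajectory, which does not meet the paths of steepest ascent from
`t₀`, connects `1` to `1 / z` in their complement. In both cases `1 ∈ D_{1/z}`, that is, `z ∈ E`.

The convergence requires that a trajectory does not accumulate at a point that is not an equilibrium
(`not_mapClusterPt`). Since `φ` is multivalued, the decrease of `Re φ` does not exclude this at once.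
Suppose that a trajectory returns to a small flow box, in which `-φ` is the coordinate, and close the
arc outside the box by a segment in the box. Locally this closed curve has two sides, since the flow
carries the sides of the segment along the arc (`IsReturn.exists_sides`). Hence the winding number
takes at most two values near the curve, and so at all points off the curve, and one of them is `0`
(`exists_int_mul_nonneg`). So the winding numbers `m` about `0` and `l` about `1 / z` do not have
opposite signs. Around the curve `φ` changes by `2πi (α m + l)`, whose imaginary part
`2π (Re α * m + l)` is bounded by the height of the box. As `Re α > 0`, this forces `m = l = 0`,
whereas `Re φ` strictly decreases around the curve (`IsReturn.false_of_height_le`).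
-/

open Set Metric MeasureTheory
open scoped NNReal ComplexConjugate

/-! ### Flows of bounded Lipschitz vector fields -/

/-- `Φ s x` is the position at time `s` of the trajectory of the vector field `X` that is at `x` at
time `0`; all trajectories are defined for all times. -/
structure IsFlow (X : ℂ → ℂ) (Φ : ℝ → ℂ → ℂ) : Prop where
  zero : ∀ x, Φ 0 x = x
  hasDerivAt : ∀ s x, HasDerivAt (fun r => Φ r x) (X (Φ s x)) s

theorem exists_isFlow {X : ℂ → ℂ} {K : ℝ≥0} (hX : LipschitzWith K X) {M : ℝ≥0}
    (hM : ∀ x, ‖X x‖ ≤ M) : ∃ Φ, IsFlow X Φ := by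
  have key : ∀ (x : ℂ) (T : ℝ), 0 < T → ∃ γ : ℝ → ℂ, γ 0 = x ∧
      ∀ t ∈ Ioo (-T) T, HasDerivAt γ (X (γ t)) t := by
    intro x T hT
    have h0 : (0 : ℝ) ∈ Icc (-T) T := ⟨by linarith, hT.le⟩
    have hPL : IsPicardLindelof (fun _ => X) (⟨0, h0⟩ : Icc (-T) T) x (M * T.toNNReal) 0 M K := by
      refine IsPicardLindelof.of_time_independent (fun y _ => hM y) hX.lipschitzOnWith ?_
      simp [hT.le]
    obtain ⟨γ, h1, h2⟩ := hPL.exists_eq_forall_mem_Icc_hasDerivWithinAt₀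
    exact ⟨γ, h1, fun t ht => (h2 t (Ioo_subset_Icc_self ht)).hasDerivAt (Icc_mem_nhds ht.1 ht.2)⟩
  choose γ hγ0 hγ using key
  have hpos : ∀ s : ℝ, 0 < |s| + 1 := fun s => by positivity
  refine ⟨fun s x => γ x (|s| + 1) (hpos s) s, fun x => hγ0 _ _ _, fun s x => ?_⟩
  have hs : s ∈ Ioo (-(|s| + 1)) (|s| + 1) := abs_lt.1 (lt_add_one _)
  refine (hγ x _ (hpos s) s hs).congr_of_eventuallyEq ?_
  filter_upwards [Ioo_mem_nhds hs.1 hs.2] with t ht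
  set T := min (|s| + 1) (|t| + 1) with hT
  have hT0 : 0 < T := lt_min (hpos s) (hpos t)
  have htT : t ∈ Ioo (-T) T := abs_lt.1 (lt_min (abs_lt.2 ht) (lt_add_one _))
  have hsub : ∀ R, T ≤ R → Ioo (-T) T ⊆ Ioo (-R) R := fun R h =>
    Ioo_subset_Ioo (neg_le_neg h) h
  refine ODE_solution_unique_of_mem_Ioo (v := fun _ => X) (s := fun _ => univ) (K := K)
    (fun _ _ => hX.lipschitzOnWith) (t₀ := 0) ⟨by linarith, hT0⟩
    (fun r hr => ⟨hγ x _ (hpos t) r (hsub _ (min_le_right _ _) hr), mem_univ _⟩)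
    (fun r hr => ⟨hγ x _ (hpos s) r (hsub _ (min_le_left _ _) hr), mem_univ _⟩) ?_ htT
  rw [hγ0, hγ0]

namespace IsFlow

variable {X : ℂ → ℂ} {Φ : ℝ → ℂ → ℂ} {K : ℝ≥0}

theorem continuous (hΦ : IsFlow X Φ) (x : ℂ) : Continuous fun s => Φ s x :=
  continuous_iff_continuousAt.2 fun s => (hΦ.hasDerivAt s x).continuousAt

theorem eq_of_hasDerivAt (hΦ : IsFlow X Φ) (hX : LipschitzWith K X) {γ : ℝ → ℂ}
    (hγ : ∀ s, HasDerivAt γ (X (γ s)) s) (s : ℝ) : γ s = Φ s (γ 0) :=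
  congrFun (ODE_solution_unique_univ (v := fun _ => X) (s := fun _ => univ) (K := K) (t₀ := 0)
    (fun _ => hX.lipschitzOnWith) (fun t => ⟨hγ t, mem_univ _⟩)
    (fun t => ⟨hΦ.hasDerivAt t (γ 0), mem_univ _⟩) (hΦ.zero _).symm) s

theorem add (hΦ : IsFlow X Φ) (hX : LipschitzWith K X) (s t : ℝ) (x : ℂ) :
    Φ (s + t) x = Φ s (Φ t x) := by
  have := hΦ.eq_of_hasDerivAt hX (γ := fun r => Φ (r + t) x)
    (fun r => (hΦ.hasDerivAt (r + t) x).comp_add_const r t) s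
  simpa using this

theorem neg (hΦ : IsFlow X Φ) : IsFlow (fun x => -X x) fun s x => Φ (-s) x :=
  ⟨fun x => by simpa using hΦ.zero x, fun s x => by
    simpa [Function.comp_def] using (hΦ.hasDerivAt (-s) x).scomp s (hasDerivAt_neg s)⟩

theorem eq_of_eq_zero (hΦ : IsFlow X Φ) (hX : LipschitzWith K X) {x : ℂ} (hx : X x = 0) (s : ℝ) :
    Φ s x = x :=
  (hΦ.eq_of_hasDerivAt hX (γ := fun _ => x) (fun r => by
    simpa [hx] using hasDerivAt_const r x) s).symm

/-- A trajectory that passes through an equilibrium is constant. -/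
theorem eq_of_mem_equilibrium (hΦ : IsFlow X Φ) (hX : LipschitzWith K X) {x p : ℂ} (hp : X p = 0)
    {s : ℝ} (hs : Φ s x = p) (t : ℝ) : Φ t x = p := by
  have := hΦ.add hX (t - s) s x
  rw [sub_add_cancel, hs, hΦ.eq_of_eq_zero hX hp] at this
  exact this

theorem dist_le (hΦ : IsFlow X Φ) (hX : LipschitzWith K X) {s : ℝ} (hs : 0 ≤ s) (x y : ℂ) :
    dist (Φ s x) (Φ s y) ≤ dist x y * Real.exp (K * s) := by
  have := dist_le_of_trajectories_ODE (v := fun _ => X) (K := K) (a := 0) (b := s)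
    (δ := dist x y) (fun _ => hX) (hΦ.continuous x).continuousOn
    (fun t _ => (hΦ.hasDerivAt t x).hasDerivWithinAt) (hΦ.continuous y).continuousOn
    (fun t _ => (hΦ.hasDerivAt t y).hasDerivWithinAt) (by rw [hΦ.zero, hΦ.zero]) s
    (right_mem_Icc.2 hs)
  simpa using this

theorem continuous_neg (hΦ : IsFlow X Φ) (hX : LipschitzWith K X) {s : ℝ} (hs : 0 ≤ s) :
    Continuous (Φ (-s)) := by
  have hX' : LipschitzWith K fun x => -X x := hX.neg
  refine (LipschitzWith.of_dist_le_mul (K := (Real.exp (K * s)).toNNReal)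
    fun x y => ?_).continuous
  rw [Real.coe_toNNReal _ (Real.exp_pos _).le, mul_comm]
  exact hΦ.neg.dist_le hX' hs x y

/-- A curve whose velocity is a continuous multiple of `X` is a reparametrized trajectory. -/
theorem eq_comp_integral (hΦ : IsFlow X Φ) (hX : LipschitzWith K X) {ℓ : ℝ → ℂ} {r : ℝ → ℝ}
    {a b : ℝ} (hr : ContinuousOn r (Icc a b)) (hℓ : ContinuousOn ℓ (Icc a b))
    (hℓ' : ∀ x ∈ Ico a b, HasDerivWithinAt ℓ (r x • X (ℓ x)) (Ici x) x) :
    ∀ x ∈ Icc a b, ℓ x = Φ (∫ y in a..x, r y) (ℓ a) := by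
  rcases lt_or_ge b a with hab | hab
  · simp [Icc_eq_empty_of_lt hab]
  set σ : ℝ → ℝ := fun x => ∫ y in a..x, r y with hσ
  have hint : IntervalIntegrable r volume a b := by
    rw [← uIcc_of_le hab] at hr
    exact hr.intervalIntegrable
  have hσc : ContinuousOn σ (Icc a b) := by
    have := intervalIntegral.continuousOn_primitive_interval (μ := volume) (f := r) (a := a)
      (b := b) (by rw [uIcc_of_le hab]; exact hr.integrableOn_Icc)
    rwa [uIcc_of_le hab] at this
  have hσ' : ∀ x ∈ Ico a b, HasDerivWithinAt σ (r x) (Ici x) x := by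
    intro x hx
    have hxI : Icc x b ⊆ Icc a b := Icc_subset_Icc_left hx.1
    have hm : Icc a b ∈ 𝓝[Ioi x] x :=
      mem_of_superset (Ioc_mem_nhdsGT hx.2) fun y hy => ⟨hx.1.trans hy.1.le, hy.2⟩
    refine intervalIntegral.integral_hasDerivWithinAt_right
      (hint.mono_set ?_) ?_ ?_
    · rw [uIcc_of_le hx.1, uIcc_of_le hab]; exact Icc_subset_Icc_right hx.2.le
    · exact ⟨Icc a b, hm, hr.aestronglyMeasurable measurableSet_Icc⟩
    · exact (hr x ⟨hx.1, hx.2.le⟩).mono_of_mem_nhdsWithin hm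
  obtain ⟨R, hR⟩ := (isCompact_Icc.image_of_continuousOn hr).isBounded.exists_norm_le
  have hR0 : 0 ≤ R := (norm_nonneg _).trans (hR _ ⟨a, left_mem_Icc.2 hab, rfl⟩)
  have hv : ∀ t ∈ Ico a b, LipschitzOnWith (R.toNNReal * K) (fun z => r t • X z) univ := by
    intro t ht
    refine LipschitzWith.lipschitzOnWith (LipschitzWith.of_dist_le_mul fun z w => ?_)
    rw [dist_smul₀, NNReal.coe_mul, Real.coe_toNNReal _ hR0, mul_assoc]
    exact mul_le_mul (hR _ ⟨t, Ico_subset_Icc_self ht, rfl⟩) (hX.dist_le_mul z w)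
      dist_nonneg hR0
  refine ODE_solution_unique_of_mem_Icc_right (v := fun t z => r t • X z) (s := fun _ => univ)
    hv hℓ hℓ' (fun _ _ => mem_univ _) ((hΦ.continuous _).comp_continuousOn hσc) ?_
    (fun _ _ => mem_univ _) ?_
  · intro t ht
    exact (hΦ.hasDerivAt (σ t) (ℓ a)).scomp_hasDerivWithinAt t (hσ' t ht)
  · simp [hΦ.zero]

end IsFlow

/-- A curve that moves inwards whenever it is on the circle of radius `ρ` about `c` cannot leave the
closed disc bounded by this circle. -/
theorem dist_le_of_inward {ℓ ℓ' : ℝ → ℂ} {a b ρ : ℝ} {c : ℂ} (hℓ : ContinuousOn ℓ (Icc a b))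
    (hℓ' : ∀ x ∈ Ico a b, HasDerivWithinAt ℓ (ℓ' x) (Ici x) x) (ha : ‖ℓ a - c‖ ≤ ρ)
    (hin : ∀ x ∈ Ico a b, ‖ℓ x - c‖ = ρ → (conj (ℓ x - c) * ℓ' x).re < 0) :
    ∀ x ∈ Icc a b, ‖ℓ x - c‖ ≤ ρ := by
  have hρ : 0 ≤ ρ := (norm_nonneg _).trans ha
  have h := image_le_of_deriv_right_lt_deriv_boundary (f := fun x => ‖ℓ x - c‖ ^ 2)
    (f' := fun x => 2 * (conj (ℓ x - c) * ℓ' x).re) (a := a) (b := b) (B := fun _ => ρ ^ 2)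
    (B' := fun _ => 0) ((hℓ.sub continuousOn_const).norm.pow 2) ?_ (by gcongr)
    (fun x => hasDerivAt_const _ _) ?_
  · intro x hx
    exact le_of_sq_le_sq (h hx) hρ
  · intro x hx
    have := ((hℓ' x hx).sub_const c).norm_sq
    convert! this using 1
    simp only [Complex.inner]
    ring_nf
  · intro x hx hxe
    have : ‖ℓ x - c‖ = ρ := by
      have := (sq_eq_sq₀ (norm_nonneg _) hρ).1 hxe
      exact this
    have := hin x hx this
    linarith

/-! ### Winding numbers -/

/-- A solution of the linear equation `h' = f h` is the exponential of a primitive of `f`. -/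
theorem eq_exp_integral_mul {f h : ℝ → ℂ} {a b : ℝ} (hab : a ≤ b) (hf : ContinuousOn f (Icc a b))
    (hh : ContinuousOn h (Icc a b))
    (hh' : ∀ x ∈ Ico a b, HasDerivWithinAt h (f x * h x) (Ici x) x) :
    h b = Complex.exp (∫ x in a..b, f x) * h a := by
  set σ : ℝ → ℂ := fun x => ∫ y in a..x, f y with hσ
  have hint : IntervalIntegrable f volume a b := by
    rw [← uIcc_of_le hab] at hf
    exact hf.intervalIntegrable
  have hσc : ContinuousOn σ (Icc a b) := by
    have := intervalIntegral.continuousOn_primitive_interval (μ := volume) (f := f) (a := a)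
      (b := b) (by rw [uIcc_of_le hab]; exact hf.integrableOn_Icc)
    rwa [uIcc_of_le hab] at this
  have hσ' : ∀ x ∈ Ico a b, HasDerivWithinAt σ (f x) (Ici x) x := by
    intro x hx
    have hm : Icc a b ∈ 𝓝[Ioi x] x :=
      mem_of_superset (Ioc_mem_nhdsGT hx.2) fun y hy => ⟨hx.1.trans hy.1.le, hy.2⟩
    refine intervalIntegral.integral_hasDerivWithinAt_right
      (hint.mono_set ?_) ?_ ?_
    · rw [uIcc_of_le hx.1, uIcc_of_le hab]; exact Icc_subset_Icc_right hx.2.le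
    · exact ⟨Icc a b, hm, hf.aestronglyMeasurable measurableSet_Icc⟩
    · exact (hf x ⟨hx.1, hx.2.le⟩).mono_of_mem_nhdsWithin hm
  have hconst := constant_of_has_deriv_right_zero (f := fun x => Complex.exp (-σ x) * h x)
    (a := a) (b := b) ((hσc.neg.cexp).mul hh) (fun x hx => by
      convert! ((hσ' x hx).neg.cexp).mul (hh' x hx) using 1
      ring) b (right_mem_Icc.2 hab)
  have h0 : σ a = 0 := by simp [hσ]
  simp only [h0, neg_zero, Complex.exp_zero, one_mul] at hconst
  rw [← hconst, ← mul_assoc, ← Complex.exp_add]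
  simp [hσ]

/-- The Cauchy integral `∫ dζ / (ζ - p)` along the curve `c`, whose velocity is `c'`. -/
noncomputable def cauchyInt (c c' : ℝ → ℂ) (a b : ℝ) (p : ℂ) : ℂ :=
  ∫ s in a..b, c' s / (c s - p)

theorem exp_cauchyInt_mul {c c' : ℝ → ℂ} {a b : ℝ} (hab : a ≤ b)
    (hc : ∀ s ∈ Icc a b, HasDerivAt c (c' s) s) (hc' : ContinuousOn c' (Icc a b)) {p : ℂ}
    (hp : p ∉ c '' Icc a b) : Complex.exp (cauchyInt c c' a b p) * (c a - p) = c b - p := by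
  have hcc : ContinuousOn c (Icc a b) := HasDerivAt.continuousOn hc
  have hne : ∀ s ∈ Icc a b, c s - p ≠ 0 := fun s hs h => hp ⟨s, hs, sub_eq_zero.1 h⟩
  refine (eq_exp_integral_mul (h := fun s => c s - p) (f := fun s => c' s / (c s - p)) hab
    (hc'.div (hcc.sub continuousOn_const) hne) (hcc.sub continuousOn_const) fun x hx => ?_).symm
  have hx' := Ico_subset_Icc_self hx
  rw [div_mul_cancel₀ _ (hne x hx')]
  exact ((hc x hx').sub_const p).hasDerivWithinAt

theorem continuousOn_cauchyInt {c c' : ℝ → ℂ} {a b : ℝ} (hab : a ≤ b)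
    (hc : ContinuousOn c (Icc a b)) (hc' : ContinuousOn c' (Icc a b)) :
    ContinuousOn (cauchyInt c c' a b) (c '' Icc a b)ᶜ := by
  intro p hp
  refine ContinuousAt.continuousWithinAt ?_
  have hK : IsCompact (c '' Icc a b) := isCompact_Icc.image_of_continuousOn hc
  obtain ⟨δ, hδ, hball⟩ := Metric.isOpen_iff.1 hK.isClosed.isOpen_compl p hp
  have hfar : ∀ q ∈ ball p (δ / 2), ∀ s ∈ Icc a b, δ / 2 ≤ ‖c s - q‖ := by
    intro q hq s hs
    by_contra! hlt
    have : c s ∈ ball p δ := by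
      rw [mem_ball] at hq ⊢
      calc dist (c s) p ≤ dist (c s) q + dist q p := dist_triangle _ _ _
        _ < δ / 2 + δ / 2 := add_lt_add (by rwa [dist_eq_norm]) hq
        _ = δ := by ring
    exact hball this ⟨s, hs, rfl⟩
  obtain ⟨M, hM⟩ := (isCompact_Icc.image_of_continuousOn hc').isBounded.exists_norm_le
  have hne : ∀ q ∈ ball p (δ / 2), ∀ s ∈ Icc a b, c s - q ≠ 0 := fun q hq s hs h0 => by
    have := hfar q hq s hs
    rw [h0, norm_zero] at this
    linarith
  have hsub : uIoc a b ⊆ Icc a b := by rw [uIoc_of_le hab]; exact Ioc_subset_Icc_self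
  have hb : ∀ᶠ q in 𝓝 p, q ∈ ball p (δ / 2) := ball_mem_nhds _ (by positivity)
  refine intervalIntegral.continuousAt_of_dominated_interval (bound := fun _ => M / (δ / 2))
    ?_ ?_ (by simp) ?_
  · filter_upwards [hb] with q hq
    exact ((hc'.div (hc.sub continuousOn_const) (hne q hq)).mono hsub).aestronglyMeasurable
      measurableSet_uIoc
  · filter_upwards [hb] with q hq
    refine Eventually.of_forall fun s hs => ?_
    rw [norm_div]
    have h1 := hM _ ⟨s, hsub hs, rfl⟩
    exact div_le_div₀ ((norm_nonneg _).trans h1) h1 (by positivity) (hfar q hq s (hsub hs))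
  · refine Eventually.of_forall fun s hs => ?_
    have := hne p (mem_ball_self (by positivity)) s (hsub hs)
    exact continuousAt_const.div (continuousAt_const.sub continuousAt_id) this

theorem tendsto_cauchyInt_cobounded {c c' : ℝ → ℂ} {a b : ℝ} (hab : a ≤ b)
    (hc : ContinuousOn c (Icc a b)) (hc' : ContinuousOn c' (Icc a b)) :
    Tendsto (cauchyInt c c' a b) (Bornology.cobounded ℂ) (𝓝 0) := by
  obtain ⟨M, hM⟩ := (isCompact_Icc.image_of_continuousOn hc').isBounded.exists_norm_le
  obtain ⟨R, hR⟩ := (isCompact_Icc.image_of_continuousOn hc).isBounded.exists_norm_le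
  have hM0 : 0 ≤ M := (norm_nonneg _).trans (hM _ ⟨a, left_mem_Icc.2 hab, rfl⟩)
  have hlim : Tendsto (fun p : ℂ => M / (‖p‖ - R) * |b - a|) (Bornology.cobounded ℂ) (𝓝 0) := by
    have h1 : Tendsto (fun p : ℂ => ‖p‖ - R) (Bornology.cobounded ℂ) atTop :=
      tendsto_atTop_add_const_right _ _ tendsto_norm_cobounded_atTop
    simpa using (h1.const_div_atTop M).mul_const |b - a|
  refine squeeze_zero_norm' ?_ hlim
  filter_upwards [tendsto_norm_cobounded_atTop.eventually_gt_atTop R] with p hp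
  refine intervalIntegral.norm_integral_le_of_norm_le_const fun s hs => ?_
  rw [uIoc_of_le hab] at hs
  have hs' := Ioc_subset_Icc_self hs
  rw [norm_div]
  have h1 := hM _ ⟨s, hs', rfl⟩
  have h2 := hR _ ⟨s, hs', rfl⟩
  refine div_le_div₀ hM0 h1 (by linarith) ?_
  have := norm_sub_norm_le p (c s)
  rw [norm_sub_rev] at this
  linarith

theorem IsPreconnected.eq_of_forall_exists_int {S : Set ℂ} (hS : IsPreconnected S) {w : ℂ → ℝ}
    (hw : ContinuousOn w S) (hint : ∀ p ∈ S, ∃ n : ℤ, w p = n) {p q : ℂ} (hp : p ∈ S)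
    (hq : q ∈ S) : w p = w q := by
  have : DiscreteTopology (range ((↑) : ℤ → ℝ)) :=
    Int.isClosedEmbedding_coe_real.toHomeomorph.symm.isEmbedding.discreteTopology
  exact hS.constant_of_mapsTo (T := range ((↑) : ℤ → ℝ)) ⟨this⟩ hw
    (fun x hx => (hint x hx).imp fun n hn => hn.symm) hp hq

/-- A continuous integer-valued function on the complement of a compact set `C` takes at a point `p`
a value that it takes arbitrarily close to `C`, because the segment from `p` to a nearest point
of `C` meets `C` only at its end. -/
theorem forall_of_forall_near {C : Set ℂ} (hC : IsCompact C) (hne : C.Nonempty) {w : ℂ → ℝ}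
    (hw : ContinuousOn w Cᶜ) (hint : ∀ p ∈ Cᶜ, ∃ n : ℤ, w p = n) {P : ℝ → Prop}
    (hnear : ∀ c ∈ C, ∀ᶠ p in 𝓝 c, p ∉ C → P (w p)) {p : ℂ} (hp : p ∉ C) : P (w p) := by
  obtain ⟨c, hc, hmin⟩ := hC.exists_infDist_eq_dist hne p
  set m : ℝ → ℂ := fun t => c + t • (p - c) with hm
  have hmc : Continuous m := by fun_prop
  have hpc : 0 < dist p c := dist_pos.2 fun h => hp (h ▸ hc)
  have hseg : ∀ t ∈ Ioc (0 : ℝ) 1, m t ∉ C := by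
    intro t ht hmem
    have h1 : Metric.infDist p C ≤ dist p (m t) := Metric.infDist_le_dist_of_mem hmem
    have h2 : p - m t = (1 - t) • (p - c) := by simp only [hm, sub_smul, one_smul]; ring
    rw [hmin, dist_eq_norm, dist_eq_norm, h2, norm_smul, Real.norm_of_nonneg (by linarith [ht.2]),
      ← dist_eq_norm] at h1
    nlinarith [ht.1]
  have hlim : Tendsto m (𝓝[>] 0) (𝓝 c) := by
    have : Tendsto m (𝓝 0) (𝓝 (m 0)) := hmc.tendsto 0
    rw [show m 0 = c by simp [hm]] at this
    exact this.mono_left nhdsWithin_le_nhds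
  obtain ⟨t, ht, ht1⟩ := ((hlim.eventually (hnear c hc)).and
    (Ioc_mem_nhdsGT (zero_lt_one (α := ℝ)))).exists
  have hpre : IsPreconnected (m '' Ioc 0 1) := isPreconnected_Ioc.image m hmc.continuousOn
  have hsub : m '' Ioc 0 1 ⊆ Cᶜ := by
    rintro _ ⟨t, ht, rfl⟩
    exact hseg t ht
  have h1 : m 1 = p := by simp [hm]
  have := hpre.eq_of_forall_exists_int (hw.mono hsub) (fun q hq => hint q (hsub hq))
    ⟨t, ht1, rfl⟩ ⟨1, ⟨one_pos, le_rfl⟩, rfl⟩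
  rw [h1] at this
  rw [← this]
  exact ht (hseg t ht1)

/-! ### Flow boxes -/

/-- A flow box: coordinates `v` with `|Re v| < a`, `|Im v| < ε` on an open set in which a primitive
of the function `P` is `-v`, so that the horizontal lines are, up to parametrization, trajectories
of any vector field `X` with `P X < 0`. The box avoids the points `0` and `q`. -/
structure IsFlowBox (P X : ℂ → ℂ) (q : ℂ) (β : ℂ → ℂ) (a ε : ℝ) : Prop where
  hasDerivAt : ∀ v : ℂ, |v.re| < a → |v.im| < ε → HasDerivAt β (-(P (β v))⁻¹) v
  ne : ∀ v : ℂ, |v.re| < a → |v.im| < ε → P (β v) ≠ 0 ∧ X (β v) ≠ 0 ∧ β v ≠ 0 ∧ β v ≠ q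
  inj : ∀ v w : ℂ, |v.re| < a → |v.im| < ε → |w.re| < a → |w.im| < ε → β v = β w → v = w
  image_mem_nhds : ∀ v : ℂ, |v.re| < a → |v.im| < ε → ∀ S ∈ 𝓝 v, β '' S ∈ 𝓝 (β v)

theorem isOpen_rectangle (a ε : ℝ) : IsOpen {v : ℂ | |v.re| < a ∧ |v.im| < ε} :=
  (isOpen_lt (continuous_abs.comp Complex.continuous_re) continuous_const).inter
    (isOpen_lt (continuous_abs.comp Complex.continuous_im) continuous_const)

/-- Every regular point is the centre of a flow box of small height: the coordinate is a local
inverse of `-(α log t + log (t - q))`, normalized to vanish at the point. -/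
theorem exists_isFlowBox {α q p : ℂ} {X : ℂ → ℂ} (hX : Continuous X) (hp0 : p ≠ 0) (hpq : p ≠ q)
    (hP : α / p + 1 / (p - q) ≠ 0) (hXp : X p ≠ 0) {ε₀ : ℝ} (hε₀ : 0 < ε₀) :
    ∃ (β : ℂ → ℂ) (a ε : ℝ), 0 < a ∧ 0 < ε ∧ ε ≤ ε₀ ∧ β 0 = p ∧
      IsFlowBox (fun t => α / t + 1 / (t - q)) X q β a ε := by
  set P : ℂ → ℂ := fun t => α / t + 1 / (t - q) with hPdef
  have hpq' : p - q ≠ 0 := sub_ne_zero.2 hpq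
  set ψ : ℂ → ℂ := fun t => -(α * Complex.log (t / p) + Complex.log ((t - q) / (p - q))) with hψ
  have hψ' : ∀ t, t / p ∈ Complex.slitPlane → (t - q) / (p - q) ∈ Complex.slitPlane →
      HasStrictDerivAt ψ (-P t) t := by
    intro t h1 h2
    have ht : t ≠ 0 := by rintro rfl; simp at h1
    have htq : t - q ≠ 0 := by intro h; simp [h] at h2
    have e1 := (((hasStrictDerivAt_id t).div_const p).clog h1).const_mul α
    have e0 : HasStrictDerivAt (fun t : ℂ => t - q) 1 t := (hasStrictDerivAt_id t).sub_const q
    have e2 := (e0.div_const (p - q)).clog h2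
    convert! (e1.add e2).neg using 1
    simp only [hPdef, id]
    field_simp
  have hs1 : p / p ∈ Complex.slitPlane := by rw [div_self hp0]; exact Complex.one_mem_slitPlane
  have hs2 : (p - q) / (p - q) ∈ Complex.slitPlane := by
    rw [div_self hpq']; exact Complex.one_mem_slitPlane
  set e := (hψ' p hs1 hs2).hasStrictFDerivAt_equiv (neg_ne_zero.2 hP) |>.toOpenPartialHomeomorph ψ
    with he
  have hecoe : ∀ t, e t = ψ t := fun t => rfl
  have hpe : p ∈ e.source := HasStrictFDerivAt.mem_toOpenPartialHomeomorph_source _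
  have hψp : ψ p = 0 := by simp [hψ, div_self hp0, div_self hpq']
  have h0t : (0 : ℂ) ∈ e.target := by
    have := e.map_source hpe
    rwa [hecoe, hψp] at this
  have he0 : e.symm 0 = p := by
    have := e.left_inv hpe
    rwa [hecoe, hψp] at this
  have hPc : ContinuousAt P p :=
    (continuousAt_const.div continuousAt_id hp0).add
      (continuousAt_const.div (continuousAt_id.sub continuousAt_const) hpq')
  have hgood : ∀ᶠ t in 𝓝 p, t / p ∈ Complex.slitPlane ∧ (t - q) / (p - q) ∈ Complex.slitPlane ∧
      P t ≠ 0 ∧ X t ≠ 0 ∧ t ≠ 0 ∧ t ≠ q := by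
    have c1 : ContinuousAt (fun t : ℂ => t / p) p := by fun_prop
    have c2 : ContinuousAt (fun t : ℂ => (t - q) / (p - q)) p := by fun_prop
    filter_upwards [c1.eventually_mem (Complex.isOpen_slitPlane.mem_nhds hs1),
      c2.eventually_mem (Complex.isOpen_slitPlane.mem_nhds hs2), hPc.eventually_ne hP,
      hX.continuousAt.eventually_ne hXp, eventually_ne_nhds hp0, eventually_ne_nhds hpq]
      with t h1 h2 h3 h4 h5 h6
    exact ⟨h1, h2, h3, h4, h5, h6⟩
  have hev : ∀ᶠ v in 𝓝 (0 : ℂ), v ∈ e.target ∧ (e.symm v / p ∈ Complex.slitPlane ∧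
      (e.symm v - q) / (p - q) ∈ Complex.slitPlane ∧ P (e.symm v) ≠ 0 ∧ X (e.symm v) ≠ 0 ∧
      e.symm v ≠ 0 ∧ e.symm v ≠ q) := by
    refine (e.open_target.eventually_mem h0t).and ?_
    have hc := e.continuousAt_symm h0t
    rw [ContinuousAt, he0] at hc
    exact hc.eventually hgood
  obtain ⟨r, hr, hball⟩ := Metric.eventually_nhds_iff_ball.1 hev
  have hin : ∀ v : ℂ, |v.re| < r / 2 → |v.im| < min (r / 2) ε₀ → v ∈ ball (0 : ℂ) r := by
    intro v h1 h2
    rw [mem_ball_zero_iff]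
    calc ‖v‖ ≤ |v.re| + |v.im| := Complex.norm_le_abs_re_add_abs_im v
      _ < r / 2 + r / 2 := add_lt_add h1 (h2.trans_le (min_le_left _ _))
      _ = r := by ring
  refine ⟨e.symm, r / 2, min (r / 2) ε₀, by positivity, lt_min (by positivity) hε₀,
    min_le_right _ _, he0, ⟨?_, ?_, ?_, ?_⟩⟩
  · intro v h1 h2
    obtain ⟨ht, g1, g2, g3, -⟩ := hball v (hin v h1 h2)
    have := e.hasDerivAt_symm ht (neg_ne_zero.2 g3) (hψ' _ g1 g2).hasDerivAt
    rwa [inv_neg] at this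
  · intro v h1 h2
    exact (hball v (hin v h1 h2)).2.2.2
  · intro v w h1 h2 h3 h4 hvw
    exact e.symm.injOn (hball v (hin v h1 h2)).1 (hball w (hin w h3 h4)).1 hvw
  · intro v h1 h2 S hS
    rw [← e.symm.map_nhds_eq (hball v (hin v h1 h2)).1]
    exact image_mem_map hS

namespace IsFlowBox

variable {P X : ℂ → ℂ} {q : ℂ} {β : ℂ → ℂ} {a ε : ℝ} {Φ : ℝ → ℂ → ℂ} {K : ℝ≥0}

theorem continuousAt (hβ : IsFlowBox P X q β a ε) {v : ℂ} (h1 : |v.re| < a) (h2 : |v.im| < ε) :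
    ContinuousAt β v := (hβ.hasDerivAt v h1 h2).continuousAt

/-- Within a flow box, the flow of `X` moves along the horizontal lines, to the right. -/
theorem exists_flow_eq (hβ : IsFlowBox P X q β a ε) (hΦ : IsFlow X Φ) (hX : LipschitzWith K X)
    (hPc : ∀ t, t ≠ 0 → t ≠ q → ContinuousAt P t)
    (hPX : ∀ t, t ≠ 0 → t ≠ q → ∃ ρ : ℝ, 0 ≤ ρ ∧ P t * X t = -ρ) {x₀ x₁ y : ℝ} (h₀ : -a < x₀)
    (h : x₀ ≤ x₁) (h₁ : x₁ < a) (hy : |y| < ε) :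
    ∃ σ : ℝ, 0 ≤ σ ∧ Φ σ (β ⟨x₀, y⟩) = β ⟨x₁, y⟩ ∧
      ∀ τ ∈ Icc 0 σ, ∃ x ∈ Icc x₀ x₁, Φ τ (β ⟨x₀, y⟩) = β ⟨x, y⟩ ∧ (τ < σ → x < x₁) := by
  have hin : ∀ x ∈ Icc x₀ x₁, |x| < a := fun x hx =>
    abs_lt.2 ⟨h₀.trans_le hx.1, hx.2.trans_lt h₁⟩
  set ℓ : ℝ → ℂ := fun x => β ⟨x, y⟩ with hℓ
  set r : ℝ → ℝ := fun x => (-(P (ℓ x) * X (ℓ x)).re)⁻¹ with hr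
  have hmk : ∀ x : ℝ, (⟨x, y⟩ : ℂ) = (x : ℂ) + y * Complex.I := fun x => by
    apply Complex.ext <;> simp
  have hℓ' : ∀ x ∈ Icc x₀ x₁, HasDerivAt ℓ (-(P (ℓ x))⁻¹) x := by
    intro x hx
    have h1 : HasDerivAt (fun x : ℝ => (⟨x, y⟩ : ℂ)) 1 x := by
      simp_rw [hmk]
      exact (Complex.ofRealCLM.hasDerivAt (x := x)).add_const _
    have := (hβ.hasDerivAt ⟨x, y⟩ (hin x hx) hy).comp_of_eq x h1 rfl
    simpa [hℓ, Function.comp_def] using this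
  have hpos : ∀ x ∈ Icc x₀ x₁, 0 < -(P (ℓ x) * X (ℓ x)).re ∧
      P (ℓ x) * X (ℓ x) = ((P (ℓ x) * X (ℓ x)).re : ℂ) := by
    intro x hx
    obtain ⟨n1, n2, n3, n4⟩ := hβ.ne ⟨x, y⟩ (hin x hx) hy
    obtain ⟨ρ, hρ, hρe⟩ := hPX _ n3 n4
    have hne : P (ℓ x) * X (ℓ x) ≠ 0 := mul_ne_zero n1 n2
    have hρe' : P (ℓ x) * X (ℓ x) = -(ρ : ℂ) := hρe
    have hρ0 : ρ ≠ 0 := by rintro rfl; exact hne (by simpa using hρe')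
    rw [hρe']
    refine ⟨by simpa using lt_of_le_of_ne hρ hρ0.symm, by simp⟩
  have hℓc : ContinuousOn ℓ (Icc x₀ x₁) := HasDerivAt.continuousOn hℓ'
  have hPℓ : ContinuousOn (fun x => P (ℓ x)) (Icc x₀ x₁) := by
    intro x hx
    obtain ⟨-, -, n3, n4⟩ := hβ.ne ⟨x, y⟩ (hin x hx) hy
    exact (hPc (ℓ x) n3 n4).comp_continuousWithinAt (hℓc x hx)
  have hrc : ContinuousOn r (Icc x₀ x₁) := by
    refine ContinuousOn.inv₀ ?_ fun x hx => (hpos x hx).1.ne'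
    exact (Complex.continuous_re.comp_continuousOn
      (hPℓ.mul (hX.continuous.comp_continuousOn hℓc))).neg
  have key := hΦ.eq_comp_integral hX hrc hℓc (fun x hx => by
    have hx' := Ico_subset_Icc_self hx
    obtain ⟨k1, k2⟩ := hpos x hx'
    suffices h : r x • X (ℓ x) = -(P (ℓ x))⁻¹ by
      rw [h]; exact (hℓ' x hx').hasDerivWithinAt
    have hP0 : P (ℓ x) ≠ 0 := (hβ.ne ⟨x, y⟩ (hin x hx') hy).1
    have hre : ((P (ℓ x) * X (ℓ x)).re : ℂ) ≠ 0 := by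
      rw [Complex.ofReal_ne_zero]; linarith
    rw [Complex.real_smul, hr]
    push_cast
    rw [inv_mul_eq_iff_eq_mul₀ (neg_ne_zero.2 hre), ← k2]
    field_simp)
  have hr0 : ∀ x ∈ Icc x₀ x₁, 0 ≤ r x := fun x hx => (inv_pos.2 (hpos x hx).1).le
  set σ : ℝ → ℝ := fun x => ∫ t in x₀..x, r t with hσ
  have hσc : ContinuousOn σ (Icc x₀ x₁) := by
    have := intervalIntegral.continuousOn_primitive_interval (μ := volume) (f := r) (a := x₀)
      (b := x₁) (by rw [uIcc_of_le h]; exact hrc.integrableOn_Icc)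
    rwa [uIcc_of_le h] at this
  have hσ0 : σ x₀ = 0 := by simp [hσ]
  refine ⟨σ x₁, intervalIntegral.integral_nonneg h hr0, (key x₁ (right_mem_Icc.2 h)).symm, ?_⟩
  intro τ hτ
  obtain ⟨x, hx, hxτ⟩ := intermediate_value_Icc h hσc (by rw [hσ0]; exact hτ)
  refine ⟨x, hx, ?_, fun hlt => lt_of_le_of_ne hx.2 ?_⟩
  · rw [← hxτ]; exact (key x hx).symm
  · rintro rfl
    exact hlt.ne hxτ.symm

/-- A trajectory at a point of a flow box runs through the box to the right. -/
theorem exists_forward (hβ : IsFlowBox P X q β a ε) (hΦ : IsFlow X Φ) (hX : LipschitzWith K X)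
    (hPc : ∀ t, t ≠ 0 → t ≠ q → ContinuousAt P t)
    (hPX : ∀ t, t ≠ 0 → t ≠ q → ∃ ρ : ℝ, 0 ≤ ρ ∧ P t * X t = -ρ) {x₀ x₁ y : ℝ} (h₀ : -a < x₀)
    (h : x₀ ≤ x₁) (h₁ : x₁ < a) (hy : |y| < ε) {z : ℂ} {s : ℝ} (hs : Φ s z = β ⟨x₀, y⟩) :
    ∃ s' : ℝ, s ≤ s' ∧ Φ s' z = β ⟨x₁, y⟩ ∧
      ∀ t ∈ Icc s s', ∃ x ∈ Icc x₀ x₁, Φ t z = β ⟨x, y⟩ ∧ (t < s' → x < x₁) := by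
  obtain ⟨σ, hσ, h2, h3⟩ := hβ.exists_flow_eq hΦ hX hPc hPX h₀ h h₁ hy
  have hadd : ∀ τ, Φ (s + τ) z = Φ τ (β ⟨x₀, y⟩) := fun τ => by
    rw [add_comm, hΦ.add hX, hs]
  refine ⟨s + σ, by linarith, by rw [hadd, h2], fun t ht => ?_⟩
  obtain ⟨x, hx, k1, k2⟩ := h3 (t - s) ⟨by linarith [ht.1], by linarith [ht.2]⟩
  refine ⟨x, hx, ?_, fun hlt => k2 (by linarith)⟩
  rw [← k1, ← hadd, add_sub_cancel]

/-- A trajectory at a point of a flow box has come through the box from the left. -/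
theorem exists_backward (hβ : IsFlowBox P X q β a ε) (hΦ : IsFlow X Φ) (hX : LipschitzWith K X)
    (hPc : ∀ t, t ≠ 0 → t ≠ q → ContinuousAt P t)
    (hPX : ∀ t, t ≠ 0 → t ≠ q → ∃ ρ : ℝ, 0 ≤ ρ ∧ P t * X t = -ρ) {x₀ x₁ y : ℝ} (h₀ : -a < x₀)
    (h : x₀ ≤ x₁) (h₁ : x₁ < a) (hy : |y| < ε) {z : ℂ} {s : ℝ} (hs : Φ s z = β ⟨x₁, y⟩) :
    ∃ s' : ℝ, s' ≤ s ∧ Φ s' z = β ⟨x₀, y⟩ ∧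
      ∀ t ∈ Icc s' s, ∃ x ∈ Icc x₀ x₁, Φ t z = β ⟨x, y⟩ ∧ (t < s → x < x₁) := by
  obtain ⟨σ, hσ, h2, h3⟩ := hβ.exists_flow_eq hΦ hX hPc hPX h₀ h h₁ hy
  have hadd : ∀ τ, Φ (s - σ + τ) z = Φ τ (β ⟨x₀, y⟩) := fun τ => by
    rw [sub_eq_add_neg, add_assoc, add_comm s, hΦ.add hX, hs, ← h2, ← hΦ.add hX]
    congr 1; ring
  refine ⟨s - σ, by linarith, by rw [← add_zero (s - σ), hadd, hΦ.zero], fun t ht => ?_⟩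
  obtain ⟨x, hx, k1, k2⟩ := h3 (t - (s - σ)) ⟨by linarith [ht.1], by linarith [ht.2]⟩
  refine ⟨x, hx, ?_, fun hlt => k2 (by linarith)⟩
  rw [← k1, ← hadd, add_sub_cancel]

end IsFlowBox

/-! ### Closed curves made of two arcs -/

/-- The winding number of a closed curve made of two arcs is an integer. -/
theorem exists_int_cauchyInt_add {c₁ c₁' c₂ c₂' : ℝ → ℂ} {a₁ b₁ a₂ b₂ : ℝ} (h₁ : a₁ ≤ b₁)
    (h₂ : a₂ ≤ b₂) (hc₁ : ∀ s ∈ Icc a₁ b₁, HasDerivAt c₁ (c₁' s) s)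
    (hc₂ : ∀ s ∈ Icc a₂ b₂, HasDerivAt c₂ (c₂' s) s) (hc₁' : ContinuousOn c₁' (Icc a₁ b₁))
    (hc₂' : ContinuousOn c₂' (Icc a₂ b₂)) (h₁₂ : c₁ b₁ = c₂ a₂) (h₂₁ : c₂ b₂ = c₁ a₁) {p : ℂ}
    (hp : p ∉ c₂ '' Icc a₂ b₂ ∪ c₁ '' Icc a₁ b₁) :
    ∃ n : ℤ, cauchyInt c₁ c₁' a₁ b₁ p + cauchyInt c₂ c₂' a₂ b₂ p = n * (2 * Real.pi * Complex.I) := by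
  rw [mem_union, not_or] at hp
  have e₁ := exp_cauchyInt_mul h₁ hc₁ hc₁' hp.2
  have e₂ := exp_cauchyInt_mul h₂ hc₂ hc₂' hp.1
  have hne : c₁ a₁ - p ≠ 0 := fun h => hp.2 ⟨a₁, left_mem_Icc.2 h₁, sub_eq_zero.1 h⟩
  rw [← h₁₂, h₂₁, ← e₁, ← mul_assoc, ← Complex.exp_add] at e₂
  rw [← Complex.exp_eq_one_iff, add_comm]
  exact mul_right_cancel₀ hne (e₂.trans (one_mul _).symm)

/-- If the winding number of a closed curve takes at most two values near the curve, then all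
winding numbers different from zero have the same sign: one of the two values is zero. -/
theorem exists_int_mul_nonneg {c₁ c₁' c₂ c₂' : ℝ → ℂ} {a₁ b₁ a₂ b₂ : ℝ} (h₁ : a₁ ≤ b₁)
    (h₂ : a₂ ≤ b₂) (hc₁ : ∀ s ∈ Icc a₁ b₁, HasDerivAt c₁ (c₁' s) s)
    (hc₂ : ∀ s ∈ Icc a₂ b₂, HasDerivAt c₂ (c₂' s) s) (hc₁' : ContinuousOn c₁' (Icc a₁ b₁))
    (hc₂' : ContinuousOn c₂' (Icc a₂ b₂)) (h₁₂ : c₁ b₁ = c₂ a₂) (h₂₁ : c₂ b₂ = c₁ a₁)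
    (hnear : ∃ S T : Set ℂ, IsPreconnected S ∧ IsPreconnected T ∧
      S ⊆ (c₂ '' Icc a₂ b₂ ∪ c₁ '' Icc a₁ b₁)ᶜ ∧ T ⊆ (c₂ '' Icc a₂ b₂ ∪ c₁ '' Icc a₁ b₁)ᶜ ∧
      ∀ c ∈ c₂ '' Icc a₂ b₂ ∪ c₁ '' Icc a₁ b₁, ∀ᶠ p in 𝓝 c,
        p ∉ c₂ '' Icc a₂ b₂ ∪ c₁ '' Icc a₁ b₁ → ∃ r ∈ S ∪ T, ∃ Q : Set ℂ, IsPreconnected Q ∧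
          Q ⊆ (c₂ '' Icc a₂ b₂ ∪ c₁ '' Icc a₁ b₁)ᶜ ∧ p ∈ Q ∧ r ∈ Q)
    {p q : ℂ} (hp : p ∉ c₂ '' Icc a₂ b₂ ∪ c₁ '' Icc a₁ b₁)
    (hq : q ∉ c₂ '' Icc a₂ b₂ ∪ c₁ '' Icc a₁ b₁) :
    ∃ m l : ℤ,
      cauchyInt c₁ c₁' a₁ b₁ p + cauchyInt c₂ c₂' a₂ b₂ p = m * (2 * Real.pi * Complex.I) ∧
      cauchyInt c₁ c₁' a₁ b₁ q + cauchyInt c₂ c₂' a₂ b₂ q = l * (2 * Real.pi * Complex.I) ∧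
      0 ≤ m * l := by
  set C := c₂ '' Icc a₂ b₂ ∪ c₁ '' Icc a₁ b₁ with hC
  set I : ℂ → ℂ := fun p => cauchyInt c₁ c₁' a₁ b₁ p + cauchyInt c₂ c₂' a₂ b₂ p with hI
  have hcc₁ : ContinuousOn c₁ (Icc a₁ b₁) := HasDerivAt.continuousOn hc₁
  have hcc₂ : ContinuousOn c₂ (Icc a₂ b₂) := HasDerivAt.continuousOn hc₂
  have hCc : IsCompact C := (isCompact_Icc.image_of_continuousOn hcc₂).union
    (isCompact_Icc.image_of_continuousOn hcc₁)
  have hCne : C.Nonempty := ⟨c₁ a₁, Or.inr ⟨a₁, left_mem_Icc.2 h₁, rfl⟩⟩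
  have hint : ∀ p ∈ Cᶜ, ∃ n : ℤ, I p = n * (2 * Real.pi * Complex.I) := fun p hp =>
    exists_int_cauchyInt_add h₁ h₂ hc₁ hc₂ hc₁' hc₂' h₁₂ h₂₁ hp
  set w : ℂ → ℝ := fun p => (I p / (2 * Real.pi * Complex.I)).re with hw
  have hwn : ∀ (p : ℂ) (n : ℤ), I p = n * (2 * Real.pi * Complex.I) → w p = n := by
    intro p n h
    simp only [hw, h]
    rw [mul_div_cancel_right₀ _ Complex.two_pi_I_ne_zero]
    simp
  have hwint : ∀ p ∈ Cᶜ, ∃ n : ℤ, w p = n := fun p hp => (hint p hp).imp (hwn p)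
  have hIc : ContinuousOn I Cᶜ :=
    ((continuousOn_cauchyInt h₁ hcc₁ hc₁').mono (compl_subset_compl.2 subset_union_right)).add
    ((continuousOn_cauchyInt h₂ hcc₂ hc₂').mono (compl_subset_compl.2 subset_union_left))
  have hwc : ContinuousOn w Cᶜ := Complex.continuous_re.comp_continuousOn (hIc.div_const _)
  obtain ⟨S, T, hS, hT, hSC, hTC, hnear⟩ := hnear
  -- `S` and `T` may be empty, so the two values are described by membership
  have hval : ∀ p ∉ C, (∃ r ∈ S, w p = w r) ∨ (∃ r ∈ T, w p = w r) := by
    intro p hp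
    refine forall_of_forall_near hCc hCne hwc hwint
      (P := fun x => (∃ r ∈ S, x = w r) ∨ (∃ r ∈ T, x = w r)) (fun c hc => ?_) hp
    filter_upwards [hnear c hc] with p hp hpC
    obtain ⟨r, hr, Q, hQ, hQC, hpQ, hrQ⟩ := hp hpC
    have := hQ.eq_of_forall_exists_int (hwc.mono hQC) (fun x hx => hwint x (hQC hx)) hpQ hrQ
    exact hr.imp (fun h => ⟨r, h, this⟩) fun h => ⟨r, h, this⟩
  have hSS : ∀ r ∈ S, ∀ r' ∈ S, w r = w r' := fun r hr r' hr' =>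
    hS.eq_of_forall_exists_int (hwc.mono hSC) (fun x hx => hwint x (hSC hx)) hr hr'
  have hTT : ∀ r ∈ T, ∀ r' ∈ T, w r = w r' := fun r hr r' hr' =>
    hT.eq_of_forall_exists_int (hwc.mono hTC) (fun x hx => hwint x (hTC hx)) hr hr'
  obtain ⟨z, hz0, hzC⟩ : ∃ z, w z = 0 ∧ z ∉ C := by
    have hlim : Tendsto I (Bornology.cobounded ℂ) (𝓝 0) := by
      simpa using (tendsto_cauchyInt_cobounded h₁ hcc₁ hc₁').add
        (tendsto_cauchyInt_cobounded h₂ hcc₂ hc₂')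
    have h1 : ∀ᶠ p in Bornology.cobounded ℂ, ‖I p‖ < 2 * Real.pi := by
      have := hlim.norm
      rw [norm_zero] at this
      exact this.eventually_lt_const (by positivity)
    have h2 : ∀ᶠ p in Bornology.cobounded ℂ, p ∉ C := hCc.isBounded
    obtain ⟨z, hz1, hz2⟩ := (h1.and h2).exists
    refine ⟨z, ?_, hz2⟩
    obtain ⟨n, hn⟩ := hint z hz2
    rw [hwn z n hn]
    rw [hn, norm_mul] at hz1
    have h3 : ‖(2 * Real.pi * Complex.I : ℂ)‖ = 2 * Real.pi := by
      simp [abs_of_pos Real.pi_pos]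
    rw [h3, Complex.norm_intCast] at hz1
    have : |(n : ℝ)| < 1 := by
      have := Real.pi_pos
      by_contra! h
      nlinarith
    have h4 : |n| < 1 := by exact_mod_cast this
    rw [Int.abs_lt_one_iff] at h4
    simp [h4]
  obtain ⟨m, hm⟩ := hint p hp
  obtain ⟨l, hl⟩ := hint q hq
  refine ⟨m, l, hm, hl, ?_⟩
  have key : 0 ≤ w p * w q := by
    rcases hval z hzC with ⟨r, hr, h⟩ | ⟨r, hr, h⟩ <;>
    rcases hval p hp with ⟨r', hr', h'⟩ | ⟨r', hr', h'⟩ <;>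
    rcases hval q hq with ⟨r'', hr'', h''⟩ | ⟨r'', hr'', h''⟩ <;>
    rw [h', h'']
    · rw [hSS r' hr' r hr, ← h, hz0, zero_mul]
    · rw [hSS r' hr' r hr, ← h, hz0, zero_mul]
    · rw [hSS r'' hr'' r hr, ← h, hz0, mul_zero]
    · rw [hTT r' hr' r'' hr'']; exact mul_self_nonneg _
    · rw [hSS r' hr' r'' hr'']; exact mul_self_nonneg _
    · rw [hTT r'' hr'' r hr, ← h, hz0, mul_zero]
    · rw [hTT r' hr' r hr, ← h, hz0, zero_mul]
    · rw [hTT r' hr' r hr, ← h, hz0, zero_mul]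
  rw [hwn p m hm, hwn q l hl] at key
  exact_mod_cast key

/-! ### The closed curve formed by a return to a flow box -/

/-- The piecewise linear function that is `y₂` left of `-b` and `y₁` right of `b`. -/
noncomputable def ramp (b y₁ y₂ x : ℝ) : ℝ :=
  y₂ + (y₁ - y₂) * ((max (-b) (min b x) + b) / (2 * b))

section ramp

variable {b y₁ y₂ x ε : ℝ}

theorem ramp_of_mem (hx : x ∈ Icc (-b) b) :
    ramp b y₁ y₂ x = y₂ + (y₁ - y₂) * ((x + b) / (2 * b)) := by
  rw [ramp, min_eq_right hx.2, max_eq_right hx.1]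

theorem ramp_of_le (hb : 0 < b) (hx : x ≤ -b) : ramp b y₁ y₂ x = y₂ := by
  rw [ramp, min_eq_right (by linarith), max_eq_left hx]
  simp

theorem ramp_of_ge (hb : 0 < b) (hx : b ≤ x) : ramp b y₁ y₂ x = y₁ := by
  rw [ramp, min_eq_left hx, max_eq_right (by linarith)]
  field_simp
  ring

theorem abs_ramp_lt (hb : 0 < b) (h₁ : |y₁| < ε) (h₂ : |y₂| < ε) : |ramp b y₁ y₂ x| < ε := by
  have hl : (0 : ℝ) ≤ (max (-b) (min b x) + b) / (2 * b) :=
    div_nonneg (by linarith [le_max_left (-b) (min b x)]) (by positivity)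
  have hr : (max (-b) (min b x) + b) / (2 * b) ≤ 1 := by
    rw [div_le_one (by positivity)]
    linarith [max_le (by linarith : -b ≤ b) (min_le_left b x)]
  have := (convex_ball (0 : ℝ) ε) (x := y₂) (by simpa using h₂) (y := y₁) (by simpa using h₁)
    (sub_nonneg.2 hr) hl (by ring)
  rw [mem_ball_zero_iff, Real.norm_eq_abs] at this
  convert this using 2
  simp only [ramp, smul_eq_mul]
  ring

theorem continuous_ramp : Continuous (ramp b y₁ y₂) := by
  unfold ramp
  fun_prop

end ramp

/-- The trajectory `γ` leaves a flow box at the time `s₁`, and `s₂` is the time of its next visit: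
between these times it does not meet the part `|Re v| ≤ b` of the box. -/
structure IsReturn (β : ℂ → ℂ) (γ : ℝ → ℂ) (a ε b y₁ y₂ s₁ s₂ : ℝ) : Prop where
  b_pos : 0 < b
  b_lt : b < a
  y₁_lt : |y₁| < ε
  y₂_lt : |y₂| < ε
  lt : s₁ < s₂
  start : γ s₁ = β ⟨b, y₁⟩
  finish : γ s₂ = β ⟨-b, y₂⟩
  avoid : ∀ s ∈ Ioo s₁ s₂, ∀ x y : ℝ, |x| ≤ b → |y| < ε → γ s ≠ β ⟨x, y⟩

/-- The arc of trajectory outside the flow box, closed up by a line segment in the box. -/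
def returnCurve (β : ℂ → ℂ) (γ : ℝ → ℂ) (b y₁ y₂ s₁ s₂ : ℝ) : Set ℂ :=
  (fun x : ℝ => β ⟨x, ramp b y₁ y₂ x⟩) '' Icc (-b) b ∪ γ '' Icc s₁ s₂

namespace IsReturn

variable {P X : ℂ → ℂ} {q z : ℂ} {β : ℂ → ℂ} {a ε b y₁ y₂ s₁ s₂ : ℝ} {Φ : ℝ → ℂ → ℂ} {K : ℝ≥0}

/-- Within the flow box, the closed curve is the graph of the piecewise linear function. -/
theorem mem_returnCurve_iff (h : IsReturn β (fun s => Φ s z) a ε b y₁ y₂ s₁ s₂)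
    (hβ : IsFlowBox P X q β a ε) (hΦ : IsFlow X Φ) (hX : LipschitzWith K X)
    (hPc : ∀ t, t ≠ 0 → t ≠ q → ContinuousAt P t)
    (hPX : ∀ t, t ≠ 0 → t ≠ q → ∃ ρ : ℝ, 0 ≤ ρ ∧ P t * X t = -ρ) {x y : ℝ} (hx : |x| < a)
    (hy : |y| < ε) :
    β ⟨x, y⟩ ∈ returnCurve β (fun s => Φ s z) b y₁ y₂ s₁ s₂ ↔ y = ramp b y₁ y₂ x := by
  have hb := h.b_pos
  have hba := h.b_lt
  obtain ⟨hx1, hx2⟩ := abs_lt.1 hx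
  have hinj : ∀ {x y x' y' : ℝ}, |x| < a → |y| < ε → |x'| < a → |y'| < ε →
      β ⟨x, y⟩ = β ⟨x', y'⟩ → x = x' ∧ y = y' := by
    intro x y x' y' h1 h2 h3 h4 h5
    have := hβ.inj ⟨x, y⟩ ⟨x', y'⟩ h1 h2 h3 h4 h5
    exact ⟨congrArg Complex.re this, congrArg Complex.im this⟩
  have hab : |b| < a := by rwa [abs_of_pos hb]
  have hab' : |-b| < a := by rwa [abs_neg]
  have hIcc : ∀ {u l r : ℝ}, u ∈ Icc l r → -a < l → r < a → |u| < a := fun hu h1 h2 =>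
    abs_lt.2 ⟨h1.trans_le hu.1, hu.2.trans_lt h2⟩
  have hst : Φ s₁ z = β ⟨b, y₁⟩ := h.start
  have hfi : Φ s₂ z = β ⟨-b, y₂⟩ := h.finish
  constructor
  · rintro (⟨x', hx', he⟩ | ⟨s, hs, he⟩)
    · obtain ⟨rfl, rfl⟩ := hinj (hIcc hx' (by linarith) hba)
        (abs_ramp_lt hb h.y₁_lt h.y₂_lt) hx hy he
      rfl
    · have he' : Φ s z = β ⟨x, y⟩ := he
      have hends : ∀ t ∈ Icc s₁ s₂, ∀ x' : ℝ, |x'| ≤ b → Φ t z = β ⟨x', y⟩ →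
          (t = s₁ ∧ x' = b ∧ y = y₁) ∨ (t = s₂ ∧ x' = -b ∧ y = y₂) := by
        intro t ht x' hx' he
        rcases eq_or_lt_of_le ht.1 with rfl | h1
        · exact Or.inl ⟨rfl, hinj (hx'.trans_lt hba) hy hab h.y₁_lt (he.symm.trans hst)⟩
        rcases eq_or_lt_of_le ht.2 with rfl | h2
        · exact Or.inr ⟨rfl, hinj (hx'.trans_lt hba) hy hab' h.y₂_lt (he.symm.trans hfi)⟩
        · exact absurd he (h.avoid t ⟨h1, h2⟩ x' y hx' hy)
      rcases le_or_gt |x| b with hxb | hxb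
      · rcases hends s hs x hxb he' with ⟨-, rfl, rfl⟩ | ⟨-, rfl, rfl⟩
        · rw [ramp_of_ge hb le_rfl]
        · rw [ramp_of_le hb le_rfl]
      rcases lt_abs.1 hxb with hxb | hxb
      · rw [ramp_of_ge hb hxb.le]
        obtain ⟨s', hs', k1, k2⟩ := hβ.exists_backward hΦ hX hPc hPX (by linarith) hxb.le hx2 hy he'
        rcases lt_or_ge s' s₁ with hlt | hge
        · obtain ⟨x', hx', k3, -⟩ := k2 s₁ ⟨hlt.le, hs.1⟩
          exact (hinj (hIcc hx' (by linarith) hx2) hy hab h.y₁_lt (k3.symm.trans hst)).2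
        · rcases hends s' ⟨hge, hs'.trans hs.2⟩ b (abs_of_pos hb).le k1 with h' | h'
          · exact h'.2.2
          · linarith [h'.2.1]
      · have hxb' : x < -b := by linarith
        rw [ramp_of_le hb hxb'.le]
        obtain ⟨s', hs', k1, k2⟩ :=
          hβ.exists_forward hΦ hX hPc hPX hx1 hxb'.le (by linarith) hy he'
        rcases lt_or_ge s₂ s' with hlt | hge
        · obtain ⟨x', hx', k3, -⟩ := k2 s₂ ⟨hs.2, hlt.le⟩
          exact (hinj (hIcc hx' hx1 (by linarith)) hy hab' h.y₂_lt (k3.symm.trans hfi)).2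
        · rcases hends s' ⟨hs.1.trans hs', hge⟩ (-b) (by rw [abs_neg, abs_of_pos hb]) k1
            with h' | h'
          · linarith [h'.2.1]
          · exact h'.2.2
  · rintro rfl
    rcases le_or_gt |x| b with hxb | hxb
    · exact Or.inl ⟨x, abs_le.1 hxb, rfl⟩
    rcases lt_abs.1 hxb with hxb | hxb
    · rw [ramp_of_ge hb hxb.le]
      obtain ⟨s', hs', k1, k2⟩ :=
        hβ.exists_forward hΦ hX hPc hPX (by linarith) hxb.le hx2 h.y₁_lt hst
      refine Or.inr ⟨s', ⟨hs', ?_⟩, k1⟩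
      by_contra! hlt
      obtain ⟨x', hx', k3, -⟩ := k2 s₂ ⟨h.lt.le, hlt.le⟩
      have := (hinj (hIcc hx' (by linarith) hx2) h.y₁_lt hab' h.y₂_lt (k3.symm.trans hfi)).1
      linarith [hx'.1]
    · have hxb' : x < -b := by linarith
      rw [ramp_of_le hb hxb'.le]
      obtain ⟨s', hs', k1, k2⟩ :=
        hβ.exists_backward hΦ hX hPc hPX hx1 hxb'.le (by linarith) h.y₂_lt hfi
      refine Or.inr ⟨s', ⟨?_, hs'⟩, k1⟩
      by_contra! hlt
      obtain ⟨x', hx', k3, -⟩ := k2 s₁ ⟨hlt.le, h.lt.le⟩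
      have := (hinj (hIcc hx' hx1 (by linarith)) h.y₂_lt hab h.y₁_lt (k3.symm.trans hst)).1
      linarith [hx'.2]

end IsReturn

namespace IsReturn

variable {P X : ℂ → ℂ} {q z : ℂ} {β : ℂ → ℂ} {a ε b y₁ y₂ s₁ s₂ : ℝ} {Φ : ℝ → ℂ → ℂ} {K : ℝ≥0}

/-- Near the closed curve, its complement consists of two sides: inside the flow box, these are the
points above and below the graph, and the flow transports them along the arc of trajectory. A point
next to this arc cannot change sides on the way, because it stays away from the segment in the box,
and other points of the curve can only be reached from the curve. -/
theorem exists_sides (h : IsReturn β (fun s => Φ s z) a ε b y₁ y₂ s₁ s₂)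
    (hβ : IsFlowBox P X q β a ε) (hΦ : IsFlow X Φ) (hX : LipschitzWith K X)
    (hPc : ∀ t, t ≠ 0 → t ≠ q → ContinuousAt P t)
    (hPX : ∀ t, t ≠ 0 → t ≠ q → ∃ ρ : ℝ, 0 ≤ ρ ∧ P t * X t = -ρ) :
    ∃ S T : Set ℂ, IsPreconnected S ∧ IsPreconnected T ∧
      S ⊆ (returnCurve β (fun s => Φ s z) b y₁ y₂ s₁ s₂)ᶜ ∧
      T ⊆ (returnCurve β (fun s => Φ s z) b y₁ y₂ s₁ s₂)ᶜ ∧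
      ∀ c ∈ returnCurve β (fun s => Φ s z) b y₁ y₂ s₁ s₂, ∀ᶠ p in 𝓝 c,
        p ∉ returnCurve β (fun s => Φ s z) b y₁ y₂ s₁ s₂ → ∃ r ∈ S ∪ T, ∃ Q : Set ℂ,
          IsPreconnected Q ∧ Q ⊆ (returnCurve β (fun s => Φ s z) b y₁ y₂ s₁ s₂)ᶜ ∧
          p ∈ Q ∧ r ∈ Q := by
  set C := returnCurve β (fun s => Φ s z) b y₁ y₂ s₁ s₂ with hC
  have hb := h.b_pos
  have hba := h.b_lt
  have ha : 0 < a := hb.trans hba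
  have hmem : ∀ {x y : ℝ}, |x| < a → |y| < ε → (β ⟨x, y⟩ ∈ C ↔ y = ramp b y₁ y₂ x) :=
    fun hx hy => h.mem_returnCurve_iff hβ hΦ hX hPc hPX hx hy
  have hramp : ∀ x, |ramp b y₁ y₂ x| < ε := fun x => abs_ramp_lt hb h.y₁_lt h.y₂_lt
  have hβc : ∀ (f : ℝ × ℝ → ℝ), Continuous f → ∀ D : Set (ℝ × ℝ),
      (∀ u ∈ D, |u.1| < a ∧ |f u| < ε) → ContinuousOn (fun u : ℝ × ℝ => β ⟨u.1, f u⟩) D := by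
    intro f hf D hD u hu
    have hmk : Continuous fun u : ℝ × ℝ => (⟨u.1, f u⟩ : ℂ) :=
      Complex.equivRealProdCLM.symm.continuous.comp (continuous_fst.prodMk hf)
    exact (ContinuousAt.comp (f := fun u : ℝ × ℝ => (⟨u.1, f u⟩ : ℂ))
      (hβ.continuousAt (v := ⟨u.1, f u⟩) (hD u hu).1 (hD u hu).2)
      hmk.continuousAt).continuousWithinAt
  set D : Set (ℝ × ℝ) := Ioo (-a) a ×ˢ Ioo (0 : ℝ) 1 with hD
  have hDp : IsPreconnected D := isPreconnected_Ioo.prod isPreconnected_Ioo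
  -- `fU` and `fL` interpolate between the graph and the upper, lower side of the box
  set fU : ℝ × ℝ → ℝ := fun u => ramp b y₁ y₂ u.1 + u.2 * (ε - ramp b y₁ y₂ u.1) with hfU
  set fL : ℝ × ℝ → ℝ := fun u => ramp b y₁ y₂ u.1 - u.2 * (ε + ramp b y₁ y₂ u.1) with hfL
  have hrc : Continuous fun u : ℝ × ℝ => ramp b y₁ y₂ u.1 := continuous_ramp.comp continuous_fst
  have hfUc : Continuous fU := by fun_prop
  have hfLc : Continuous fL := by fun_prop
  have hUD : ∀ u ∈ D, |u.1| < a ∧ |fU u| < ε ∧ ramp b y₁ y₂ u.1 < fU u := by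
    rintro ⟨x, t⟩ ⟨hx, ht⟩
    obtain ⟨h1, h2⟩ := abs_lt.1 (hramp x)
    simp only [mem_Ioo] at ht
    refine ⟨abs_lt.2 hx, abs_lt.2 ⟨?_, ?_⟩, ?_⟩ <;> simp only [hfU] <;> nlinarith
  have hLD : ∀ u ∈ D, |u.1| < a ∧ |fL u| < ε ∧ fL u < ramp b y₁ y₂ u.1 := by
    rintro ⟨x, t⟩ ⟨hx, ht⟩
    obtain ⟨h1, h2⟩ := abs_lt.1 (hramp x)
    simp only [mem_Ioo] at ht
    refine ⟨abs_lt.2 hx, abs_lt.2 ⟨?_, ?_⟩, ?_⟩ <;> simp only [hfL] <;> nlinarith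
  set S : Set ℂ := (fun u : ℝ × ℝ => β ⟨u.1, fU u⟩) '' D with hS
  set T : Set ℂ := (fun u : ℝ × ℝ => β ⟨u.1, fL u⟩) '' D with hT
  have hbox : ∀ {x y : ℝ}, |x| < a → |y| < ε → β ⟨x, y⟩ ∉ C → β ⟨x, y⟩ ∈ S ∪ T := by
    intro x y hx hy hnot
    rw [hmem hx hy] at hnot
    obtain ⟨h1, h2⟩ := abs_lt.1 (hramp x)
    obtain ⟨h3, h4⟩ := abs_lt.1 hy
    rcases lt_or_gt_of_ne hnot with hlt | hgt
    · refine Or.inr ⟨⟨x, (ramp b y₁ y₂ x - y) / (ε + ramp b y₁ y₂ x)⟩, ⟨abs_lt.1 hx,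
        div_pos (by linarith) (by linarith), (div_lt_one (by linarith)).2 (by linarith)⟩, ?_⟩
      simp only [hfL]
      rw [div_mul_cancel₀ _ (by linarith : ε + ramp b y₁ y₂ x ≠ 0)]
      congr 2; ring
    · refine Or.inl ⟨⟨x, (y - ramp b y₁ y₂ x) / (ε - ramp b y₁ y₂ x)⟩, ⟨abs_lt.1 hx,
        div_pos (by linarith) (by linarith), (div_lt_one (by linarith)).2 (by linarith)⟩, ?_⟩
      simp only [hfU]
      rw [div_mul_cancel₀ _ (by linarith : ε - ramp b y₁ y₂ x ≠ 0)]
      congr 2; ring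
  have hnearbox : ∀ {x y : ℝ}, |x| < a → |y| < ε →
      ∀ᶠ p in 𝓝 (β ⟨x, y⟩), p ∉ C → p ∈ S ∪ T := by
    intro x y hx hy
    filter_upwards [hβ.image_mem_nhds ⟨x, y⟩ hx hy _ ((isOpen_rectangle a ε).mem_nhds ⟨hx, hy⟩)]
    rintro _ ⟨v, ⟨hv1, hv2⟩, rfl⟩ hv
    exact hbox hv1 hv2 hv
  have hnearbox' : ∀ {x y : ℝ}, |x| < a → |y| < ε → ∀ᶠ p in 𝓝 (β ⟨x, y⟩),
      p ∉ C → ∃ r ∈ S ∪ T, ∃ Q : Set ℂ, IsPreconnected Q ∧ Q ⊆ Cᶜ ∧ p ∈ Q ∧ r ∈ Q := by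
    intro x y hx hy
    filter_upwards [hnearbox hx hy] with p hp hpC
    exact ⟨p, hp hpC, {p}, isPreconnected_singleton, by simpa using hpC, rfl, rfl⟩
  refine ⟨S, T, hDp.image _ (hβc _ hfUc D fun u hu => ⟨(hUD u hu).1, (hUD u hu).2.1⟩),
    hDp.image _ (hβc _ hfLc D fun u hu => ⟨(hLD u hu).1, (hLD u hu).2.1⟩), ?_, ?_, ?_⟩
  · rintro _ ⟨u, hu, rfl⟩ hin
    obtain ⟨k1, k2, k3⟩ := hUD u hu
    exact k3.ne' ((hmem k1 k2).1 hin)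
  · rintro _ ⟨u, hu, rfl⟩ hin
    obtain ⟨k1, k2, k3⟩ := hLD u hu
    exact k3.ne ((hmem k1 k2).1 hin)
  rintro c (⟨x, hx, rfl⟩ | ⟨s, hs, rfl⟩)
  · exact hnearbox' (abs_lt.2 ⟨by linarith [hx.1], hx.2.trans_lt hba⟩) (hramp x)
  set d := (a + b) / 2 with hd
  have hbd : b < d := by rw [hd]; linarith
  have hda : d < a := by rw [hd]; linarith
  have hst : Φ s₁ z = β ⟨b, y₁⟩ := h.start
  have hfi : Φ s₂ z = β ⟨-b, y₂⟩ := h.finish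
  obtain ⟨s₁', h11, h12, h13⟩ :=
    hβ.exists_forward hΦ hX hPc hPX (by linarith) hbd.le hda h.y₁_lt hst
  obtain ⟨s₂', h21, h22, h23⟩ := hβ.exists_backward hΦ hX hPc hPX (x₀ := -d) (by linarith)
    (by linarith) (by linarith) h.y₂_lt hfi
  rcases le_or_gt s s₁' with hs1 | hs1
  · obtain ⟨x, hx, k, -⟩ := h13 s ⟨hs.1, hs1⟩
    simp only [k]
    exact hnearbox' (abs_lt.2 ⟨by linarith [hx.1], by linarith [hx.2]⟩) h.y₁_lt
  rcases le_or_gt s₂' s with hs2 | hs2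
  · obtain ⟨x, hx, k, -⟩ := h23 s ⟨hs2, hs.2⟩
    simp only [k]
    exact hnearbox' (abs_lt.2 ⟨by linarith [hx.1], by linarith [hx.2]⟩) h.y₂_lt
  have hs1ne : s₁ ≠ s₁' := by
    intro he
    rw [← he, hst] at h12
    have := congrArg Complex.re (hβ.inj ⟨b, y₁⟩ ⟨d, y₁⟩ (by rwa [abs_of_pos hb]) h.y₁_lt
      (by rwa [abs_of_pos (hb.trans hbd)]) h.y₁_lt h12)
    exact hbd.ne this
  have hs2ne : s₂' ≠ s₂ := by
    intro he
    rw [he, hfi] at h22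
    have := congrArg Complex.re (hβ.inj ⟨-b, y₂⟩ ⟨-d, y₂⟩
      (by rw [abs_neg]; rwa [abs_of_pos hb]) h.y₂_lt
      (by rw [abs_neg]; rwa [abs_of_pos (hb.trans hbd)]) h.y₂_lt h22)
    exact hbd.ne (neg_injective this)
  set R : Set ℂ := (fun x : ℝ => β ⟨x, ramp b y₁ y₂ x⟩) '' Icc (-b) b with hR
  have hRcpt : IsCompact R := by
    refine isCompact_Icc.image_of_continuousOn ?_
    have := hβc (fun u => ramp b y₁ y₂ u.1) hrc (Icc (-b) b ×ˢ univ) (fun u hu =>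
      ⟨abs_lt.2 ⟨by linarith [hu.1.1], hu.1.2.trans_lt hba⟩, hramp _⟩)
    exact this.comp (f := fun x : ℝ => (x, x)) (by fun_prop) fun x hx => ⟨hx, mem_univ _⟩
  have hGcpt : IsCompact ((fun s => Φ s z) '' Icc s₁' s₂') :=
    isCompact_Icc.image (hΦ.continuous z)
  have hdisj : Disjoint ((fun s => Φ s z) '' Icc s₁' s₂') R := by
    rw [Set.disjoint_left]
    rintro _ ⟨t, ht, rfl⟩ ⟨x, hx, he⟩
    exact h.avoid t ⟨(lt_of_le_of_ne h11 hs1ne).trans_le ht.1,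
      ht.2.trans_lt (lt_of_le_of_ne h21 hs2ne)⟩ x _ (abs_le.2 hx) (hramp x) he.symm
  obtain ⟨δ, hδ, hδd⟩ := hdisj.exists_thickenings hGcpt hRcpt.isClosed
  -- points close to `γ s₁'` do not meet the segment while the flow carries them along the arc
  have hB : ∀ᶠ p in 𝓝 (Φ s₁' z), ∀ σ ∈ Icc 0 (s₂' - s₁'), Φ σ p ∉ R := by
    have hE : 0 < Real.exp (K * (s₂' - s₁')) := Real.exp_pos _
    filter_upwards [ball_mem_nhds (Φ s₁' z) (div_pos hδ hE)] with p hp σ hσ hmemR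
    refine absurd (self_subset_thickening hδ _ hmemR) (Set.disjoint_left.1 hδd ?_)
    rw [mem_thickening_iff]
    refine ⟨Φ (σ + s₁') z, ⟨σ + s₁', ⟨by linarith [hσ.1], by linarith [hσ.2]⟩, rfl⟩, ?_⟩
    rw [hΦ.add hX]
    calc dist (Φ σ p) (Φ σ (Φ s₁' z)) ≤ dist p (Φ s₁' z) * Real.exp (K * σ) :=
          hΦ.dist_le hX hσ.1 _ _
      _ ≤ dist p (Φ s₁' z) * Real.exp (K * (s₂' - s₁')) := by gcongr; exact hσ.2
      _ < δ := by rwa [mem_ball, lt_div_iff₀ hE] at hp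
  have hsides := hnearbox (x := d) (by rwa [abs_of_pos (hb.trans hbd)]) h.y₁_lt
  rw [← h12] at hsides
  have hsrc := hB.and hsides
  have hlen : 0 ≤ s - s₁' := by linarith
  have hs₁R : Φ s₁ z ∈ R := ⟨b, ⟨by linarith, le_rfl⟩, by simp only [hst, ramp_of_ge hb le_rfl]⟩
  have hs₂R : Φ s₂ z ∈ R := ⟨-b, ⟨le_rfl, by linarith⟩, by simp only [hfi, ramp_of_le hb le_rfl]⟩
  have hcont : Tendsto (Φ (-(s - s₁'))) (𝓝 (Φ s z)) (𝓝 (Φ s₁' z)) := by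
    have := (hΦ.continuous_neg hX hlen).tendsto (Φ s z)
    rwa [← hΦ.add hX, show -(s - s₁') + s = s₁' by ring] at this
  -- carry `p` back along the flow to the point `p₀` in the box; if the path from `p₀` to `p` met the
  -- curve, then `p` would be on the curve, or the path would meet the segment at an end of the arc
  filter_upwards [hcont.eventually hsrc] with p hp hpC
  obtain ⟨hpR, hpS⟩ := hp
  set p₀ := Φ (-(s - s₁')) p with hp₀
  have hpp : Φ (s - s₁') p₀ = p := by
    rw [hp₀, ← hΦ.add hX, add_neg_cancel, hΦ.zero]
  have hle : ∀ σ ∈ Icc 0 (s - s₁'), Φ σ p₀ ∉ R := fun σ hσ =>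
    hpR σ ⟨hσ.1, by linarith [hσ.2]⟩
  have hadd : ∀ {t σ}, Φ t z = p₀ → Φ (t + σ) z = Φ σ p₀ := fun {t σ} ht => by
    rw [add_comm, hΦ.add hX, ht]
  have hp₀C : p₀ ∉ C := by
    rintro (hin | ⟨t, ht, he⟩)
    · exact hle 0 ⟨le_rfl, hlen⟩ (by rwa [hΦ.zero])
    · have he' : Φ t z = p₀ := he
      rcases le_or_gt (t + (s - s₁')) s₂ with h1 | h1
      · exact hpC (Or.inr ⟨t + (s - s₁'), ⟨by linarith [ht.1], h1⟩, (hadd he').trans hpp⟩)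
      · refine hle (s₂ - t) ⟨by linarith [ht.2], by linarith⟩ ?_
        rwa [← hadd he', add_sub_cancel]
  refine ⟨p₀, hpS hp₀C, (fun σ => Φ σ p₀) '' Icc 0 (s - s₁'),
    isPreconnected_Icc.image _ (hΦ.continuous p₀).continuousOn, ?_,
    ⟨s - s₁', right_mem_Icc.2 hlen, hpp⟩, ⟨0, left_mem_Icc.2 hlen, hΦ.zero p₀⟩⟩
  rintro _ ⟨σ, hσ, rfl⟩ (hin | ⟨t, ht, he⟩)
  · exact hle σ hσ hin
  · have he' : Φ t z = Φ σ p₀ := he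
    have ht₀ : Φ (t - σ) z = p₀ := by
      rw [sub_eq_add_neg, add_comm, hΦ.add hX, he', ← hΦ.add hX, neg_add_cancel, hΦ.zero]
    rcases le_or_gt s₁ (t - σ) with h1 | h1
    · exact hp₀C (Or.inr ⟨t - σ, ⟨h1, by linarith [hσ.1, ht.2]⟩, ht₀⟩)
    · refine hle (s₁ - (t - σ)) ⟨by linarith, by linarith [ht.1, hσ.2]⟩ ?_
      rwa [← hadd ht₀, add_sub_cancel]

end IsReturn

/-! ### Trajectories do not accumulate at regular points -/

namespace IsReturn

variable {X : ℂ → ℂ} {α q z : ℂ} {β : ℂ → ℂ} {a ε b y₁ y₂ s₁ s₂ : ℝ} {Φ : ℝ → ℂ → ℂ} {K : ℝ≥0}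

/-- Returns to a flow box of small height do not exist: around the closed curve, `φ` changes by
`2πi (α m + l)`, where the winding numbers `m` about `0` and `l` about `q` do not have opposite
signs. The imaginary part of this number is the difference of height in the flow box, so that
`m = l = 0`; but the real part of `φ` decreases along the curve. -/
theorem false_of_height_le (h : IsReturn β (fun s => Φ s z) a ε b y₁ y₂ s₁ s₂)
    (hβ : IsFlowBox (fun t => α / t + 1 / (t - q)) X q β a ε) (hΦ : IsFlow X Φ)
    (hX : LipschitzWith K X) (hα : 0 < α.re) (hX0 : X 0 = 0) (hXq : X q = 0)
    (hPX : ∀ t, t ≠ 0 → t ≠ q → ∃ ρ : ℝ, 0 ≤ ρ ∧ (α / t + 1 / (t - q)) * X t = -ρ)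
    (hε1 : ε ≤ 1) (hεα : ε ≤ α.re) : False := by
  have hPc : ∀ t, t ≠ 0 → t ≠ q → ContinuousAt (fun t => α / t + 1 / (t - q)) t :=
    fun t h0 hq => (continuousAt_const.div continuousAt_id h0).add
      (continuousAt_const.div (continuousAt_id.sub continuousAt_const) (sub_ne_zero.2 hq))
  obtain ⟨S, T, hS, hT, hSC, hTC, hnear⟩ := h.exists_sides hβ hΦ hX hPc hPX
  have hb := h.b_pos
  have hba := h.b_lt
  have hramp : ∀ x, |ramp b y₁ y₂ x| < ε := fun x => abs_ramp_lt hb h.y₁_lt h.y₂_lt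
  -- `ℓ` is the segment in the coordinates of the box, of slope `κ`
  set κ : ℝ := (y₁ - y₂) / (2 * b) with hκ
  set ℓ : ℝ → ℂ := fun x => x + (y₂ + κ * (x + b) : ℝ) * Complex.I with hℓ
  have hℓr : ∀ x ∈ Icc (-b) b, ℓ x = ⟨x, ramp b y₁ y₂ x⟩ := by
    intro x hx
    rw [ramp_of_mem hx]
    apply Complex.ext
    · simp [hℓ]
    · simp only [hℓ, Complex.add_im, Complex.ofReal_im, Complex.mul_im, Complex.ofReal_re,
        Complex.I_im, Complex.I_re]
      rw [hκ]
      ring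
  have hin : ∀ x ∈ Icc (-b) b, |(ℓ x).re| < a ∧ |(ℓ x).im| < ε := by
    intro x hx
    rw [hℓr x hx]
    exact ⟨abs_lt.2 ⟨by linarith [hx.1], hx.2.trans_lt hba⟩, hramp x⟩
  have hℓ' : ∀ x, HasDerivAt ℓ (1 + κ * Complex.I) x := by
    intro x
    have e1 : HasDerivAt (fun x : ℝ => (x : ℂ)) 1 x := Complex.ofRealCLM.hasDerivAt
    have e2 : HasDerivAt (fun x : ℝ => ((y₂ + κ * (x + b) : ℝ) : ℂ)) κ x := by
      have : HasDerivAt (fun x : ℝ => y₂ + κ * (x + b)) κ x := by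
        simpa using (((hasDerivAt_id x).add_const b).const_mul κ).const_add y₂
      exact this.ofReal_comp
    exact e1.add (e2.mul_const _)
  set P : ℂ → ℂ := fun t => α / t + 1 / (t - q) with hP
  set c₂ : ℝ → ℂ := fun x => β (ℓ x) with hc₂
  set c₂' : ℝ → ℂ := fun x => (1 + κ * Complex.I) * -(P (β (ℓ x)))⁻¹ with hc₂'
  have hd₂ : ∀ x ∈ Icc (-b) b, HasDerivAt c₂ (c₂' x) x := fun x hx =>
    (hβ.hasDerivAt _ (hin x hx).1 (hin x hx).2).scomp x (hℓ' x)
  have hne₂ : ∀ x ∈ Icc (-b) b, P (c₂ x) ≠ 0 ∧ X (c₂ x) ≠ 0 ∧ c₂ x ≠ 0 ∧ c₂ x ≠ q := fun x hx =>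
    hβ.ne _ (hin x hx).1 (hin x hx).2
  have hc₂c : ContinuousOn c₂ (Icc (-b) b) := HasDerivAt.continuousOn hd₂
  have hd₂c : ContinuousOn c₂' (Icc (-b) b) := by
    refine continuousOn_const.mul (ContinuousOn.neg (ContinuousOn.inv₀ (fun x hx => ?_)
      fun x hx => (hne₂ x hx).1))
    exact (hPc _ (hne₂ x hx).2.2.1 (hne₂ x hx).2.2.2).comp_continuousWithinAt (hc₂c x hx)
  set c₁ : ℝ → ℂ := fun s => Φ s z with hc₁
  set c₁' : ℝ → ℂ := fun s => X (Φ s z) with hc₁'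
  have hd₁ : ∀ s ∈ Icc s₁ s₂, HasDerivAt c₁ (c₁' s) s := fun s _ => hΦ.hasDerivAt s z
  have hc₁c : Continuous c₁ := hΦ.continuous z
  have hd₁c : Continuous c₁' := hX.continuous.comp hc₁c
  have hC : c₂ '' Icc (-b) b ∪ c₁ '' Icc s₁ s₂ = returnCurve β (fun s => Φ s z) b y₁ y₂ s₁ s₂ := by
    rw [returnCurve]
    congr 1
    exact image_congr fun x hx => congrArg β (hℓr x hx)
  have hbb : -b ≤ b := by linarith
  have h₁₂ : c₁ s₂ = c₂ (-b) := by
    simp only [hc₁, hc₂]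
    rw [hℓr _ (left_mem_Icc.2 hbb), ramp_of_le hb le_rfl]
    exact h.finish
  have h₂₁ : c₂ b = c₁ s₁ := by
    simp only [hc₁, hc₂]
    rw [hℓr _ (right_mem_Icc.2 hbb), ramp_of_ge hb le_rfl]
    exact h.start.symm
  have hst : c₁ s₁ ≠ 0 ∧ c₁ s₁ ≠ q := by
    rw [← h₂₁]
    exact (hne₂ b (right_mem_Icc.2 hbb)).2.2
  have hne₁ : ∀ s, c₁ s ≠ 0 ∧ c₁ s ≠ q := fun s =>
    ⟨fun he => hst.1 (hΦ.eq_of_mem_equilibrium hX hX0 he s₁),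
      fun he => hst.2 (hΦ.eq_of_mem_equilibrium hX hXq he s₁)⟩
  have h0C : (0 : ℂ) ∉ c₂ '' Icc (-b) b ∪ c₁ '' Icc s₁ s₂ := by
    rintro (⟨x, hx, he⟩ | ⟨s, hs, he⟩)
    · exact (hne₂ x hx).2.2.1 he
    · exact (hne₁ s).1 he
  have hqC : q ∉ c₂ '' Icc (-b) b ∪ c₁ '' Icc s₁ s₂ := by
    rintro (⟨x, hx, he⟩ | ⟨s, hs, he⟩)
    · exact (hne₂ x hx).2.2.2 he
    · exact (hne₁ s).2 he
  obtain ⟨m, l, hm, hl, hml⟩ := exists_int_mul_nonneg h.lt.le hbb hd₁ hd₂ hd₁c.continuousOn hd₂c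
    h₁₂ h₂₁ (by rw [hC]; exact ⟨S, T, hS, hT, hSC, hTC, hnear⟩) h0C hqC
  have hI₁ : α * cauchyInt c₁ c₁' s₁ s₂ 0 + cauchyInt c₁ c₁' s₁ s₂ q =
      ∫ s in s₁..s₂, P (c₁ s) * c₁' s := by
    have i1 : IntervalIntegrable (fun s => c₁' s / (c₁ s - 0)) volume s₁ s₂ :=
      (hd₁c.div (hc₁c.sub continuous_const)
        fun s => sub_ne_zero.2 (hne₁ s).1).intervalIntegrable _ _
    have i2 : IntervalIntegrable (fun s => c₁' s / (c₁ s - q)) volume s₁ s₂ :=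
      (hd₁c.div (hc₁c.sub continuous_const)
        fun s => sub_ne_zero.2 (hne₁ s).2).intervalIntegrable _ _
    rw [cauchyInt, cauchyInt, ← intervalIntegral.integral_const_mul,
      ← intervalIntegral.integral_add (i1.const_mul α) i2]
    refine intervalIntegral.integral_congr fun s _ => ?_
    simp only [hP, sub_zero]
    ring
  have hI₂ : α * cauchyInt c₂ c₂' (-b) b 0 + cauchyInt c₂ c₂' (-b) b q =
      ∫ x in (-b)..b, -(1 + κ * Complex.I) := by
    have i1 : IntervalIntegrable (fun s => c₂' s / (c₂ s - 0)) volume (-b) b := by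
      refine ContinuousOn.intervalIntegrable ?_
      rw [uIcc_of_le hbb]
      exact hd₂c.div (hc₂c.sub continuousOn_const) fun s hs => sub_ne_zero.2 (hne₂ s hs).2.2.1
    have i2 : IntervalIntegrable (fun s => c₂' s / (c₂ s - q)) volume (-b) b := by
      refine ContinuousOn.intervalIntegrable ?_
      rw [uIcc_of_le hbb]
      exact hd₂c.div (hc₂c.sub continuousOn_const) fun s hs => sub_ne_zero.2 (hne₂ s hs).2.2.2
    rw [cauchyInt, cauchyInt, ← intervalIntegral.integral_const_mul,
      ← intervalIntegral.integral_add (i1.const_mul α) i2]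
    refine intervalIntegral.integral_congr fun s hs => ?_
    rw [uIcc_of_le hbb] at hs
    have e : α * (c₂' s / (c₂ s - 0)) + c₂' s / (c₂ s - q) = P (c₂ s) * c₂' s := by
      simp only [hP, sub_zero]
      ring
    have h0 : P (β (ℓ s)) ≠ 0 := (hne₂ s hs).1
    rw [e]
    simp only [hc₂', hc₂]
    field_simp
  choose! ρ hρ using hPX
  have hI₁' : ∫ s in s₁..s₂, P (c₁ s) * c₁' s = -((∫ s in s₁..s₂, ρ (c₁ s) : ℝ) : ℂ) := by
    rw [← intervalIntegral.integral_ofReal, ← intervalIntegral.integral_neg]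
    exact intervalIntegral.integral_congr fun s _ => (hρ _ (hne₁ s).1 (hne₁ s).2).2
  have hρ0 : 0 ≤ ∫ s in s₁..s₂, ρ (c₁ s) :=
    intervalIntegral.integral_nonneg h.lt.le fun s _ => (hρ _ (hne₁ s).1 (hne₁ s).2).1
  have hκb : κ * (2 * b) = y₁ - y₂ := by rw [hκ]; field_simp
  have htot : α * (m * (2 * Real.pi * Complex.I)) + l * (2 * Real.pi * Complex.I) =
      -((∫ s in s₁..s₂, ρ (c₁ s) : ℝ) : ℂ) + (b - -b : ℝ) • -(1 + κ * Complex.I) := by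
    rw [← intervalIntegral.integral_const, ← hI₁', ← hI₁, ← hI₂, ← hm, ← hl]
    ring
  have him := congrArg Complex.im htot
  have hre := congrArg Complex.re htot
  simp at him hre
  obtain ⟨k1, k2⟩ := abs_lt.1 h.y₁_lt
  obtain ⟨k3, k4⟩ := abs_lt.1 h.y₂_lt
  have hπ : 3 < Real.pi := Real.pi_gt_three
  -- `2π (Re α m + l) = y₂ - y₁`, which is less than `2ε` in absolute value
  have hsmall : |α.re * m + l| < ε := by
    have : 2 * Real.pi * (α.re * m + l) = -(y₁ - y₂) := by
      rw [← hκb]; linarith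
    rw [abs_lt]
    constructor <;> nlinarith
  obtain ⟨hs1, hs2⟩ := abs_lt.1 hsmall
  have hml0 : m = 0 ∧ l = 0 := by
    rcases lt_trichotomy m 0 with hm0 | hm0 | hm0
    · have hl0 : l ≤ 0 := by nlinarith
      have a1 : (m : ℝ) ≤ -1 := by exact_mod_cast (by omega : m ≤ -1)
      have a2 : (l : ℝ) ≤ 0 := by exact_mod_cast hl0
      nlinarith
    · refine ⟨hm0, ?_⟩
      rw [hm0] at hs1 hs2
      simp only [Int.cast_zero, mul_zero, zero_add] at hs1 hs2
      have a1 : (-1 : ℝ) < l := by linarith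
      have a2 : (l : ℝ) < 1 := by linarith
      have a3 : -1 < l := by exact_mod_cast a1
      have a4 : l < 1 := by exact_mod_cast a2
      omega
    · have hl0 : 0 ≤ l := by nlinarith
      have a1 : (1 : ℝ) ≤ m := by exact_mod_cast (by omega : 1 ≤ m)
      have a2 : (0 : ℝ) ≤ l := by exact_mod_cast hl0
      nlinarith
  obtain ⟨rfl, rfl⟩ := hml0
  simp at hre
  linarith

end IsReturn

theorem IsFlowBox.mono {P X : ℂ → ℂ} {q : ℂ} {β : ℂ → ℂ} {a ε ε' : ℝ}
    (hβ : IsFlowBox P X q β a ε) (h : ε' ≤ ε) : IsFlowBox P X q β a ε' :=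
  ⟨fun v h1 h2 => hβ.hasDerivAt v h1 (h2.trans_le h), fun v h1 h2 => hβ.ne v h1 (h2.trans_le h),
    fun v w h1 h2 h3 h4 => hβ.inj v w h1 (h2.trans_le h) h3 (h4.trans_le h),
    fun v h1 h2 => hβ.image_mem_nhds v h1 (h2.trans_le h)⟩

/-- A trajectory that keeps coming close to a point of a flow box returns to the box. -/
theorem exists_isReturn {P X : ℂ → ℂ} {q z : ℂ} {β : ℂ → ℂ} {a ε : ℝ} {Φ : ℝ → ℂ → ℂ} {K : ℝ≥0}
    (hβ : IsFlowBox P X q β a ε) (ha : 0 < a) (hε : 0 < ε) (hΦ : IsFlow X Φ)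
    (hX : LipschitzWith K X) (hPc : ∀ t, t ≠ 0 → t ≠ q → ContinuousAt P t)
    (hPX : ∀ t, t ≠ 0 → t ≠ q → ∃ ρ : ℝ, 0 ≤ ρ ∧ P t * X t = -ρ)
    (hz : MapClusterPt (β 0) atTop fun s => Φ s z) :
    ∃ b y₁ y₂ s₁ s₂ : ℝ, IsReturn β (fun s => Φ s z) a (ε / 2) b y₁ y₂ s₁ s₂ := by
  set b := a / 2 with hbdef
  have hb : 0 < b := by positivity
  have hba : b < a := by rw [hbdef]; linarith
  set ε' := ε / 2 with hε'
  have hε'0 : 0 < ε' := by positivity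
  have hε'ε : ε' < ε := by rw [hε']; linarith
  have hab : |b| < a := by rwa [abs_of_pos hb]
  have hab' : |-b| < a := by rwa [abs_neg]
  have hvisit : ∀ M : ℝ, ∃ t ≥ M, ∃ x y : ℝ, |x| < b ∧ |y| < ε' ∧ Φ t z = β ⟨x, y⟩ := by
    intro M
    have hn : β '' {v : ℂ | |v.re| < b ∧ |v.im| < ε'} ∈ 𝓝 (β 0) :=
      hβ.image_mem_nhds 0 (by simpa using ha) (by simpa using hε) _
        ((isOpen_rectangle b ε').mem_nhds ⟨by simpa using hb, by simpa using hε'0⟩)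
    obtain ⟨t, ht, ⟨x, y⟩, ⟨h1, h2⟩, h3⟩ := (frequently_atTop.1 (mapClusterPt_iff_frequently.1 hz _ hn)) M
    exact ⟨t, ht, x, y, h1, h2, h3.symm⟩
  have hinj : ∀ {x y x' y' : ℝ}, |x| < a → |y| < ε → |x'| < a → |y'| < ε →
      β ⟨x, y⟩ = β ⟨x', y'⟩ → x = x' ∧ y = y' := by
    intro x y x' y' h1 h2 h3 h4 h5
    have := hβ.inj ⟨x, y⟩ ⟨x', y'⟩ h1 h2 h3 h4 h5
    exact ⟨congrArg Complex.re this, congrArg Complex.im this⟩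
  obtain ⟨t₁, -, x₁, y₁, hx₁, hy₁, ht₁⟩ := hvisit 0
  obtain ⟨hx₁l, hx₁r⟩ := abs_lt.1 hx₁
  obtain ⟨s₁, -, hs₁, -⟩ := hβ.exists_forward hΦ hX hPc hPX (by linarith) hx₁r.le hba
    (hy₁.trans hε'ε) ht₁
  -- visits to the left edge of the box
  set V : Set ℝ := {s | s₁ ≤ s ∧ ∃ y : ℝ, |y| < ε' ∧ Φ s z = β ⟨-b, y⟩} with hV
  have hVne : V.Nonempty := by
    obtain ⟨t, ht, x, y, hx, hy, he⟩ := hvisit s₁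
    obtain ⟨hxl, hxr⟩ := abs_lt.1 hx
    obtain ⟨s, -, hs, hs'⟩ := hβ.exists_backward hΦ hX hPc hPX (by linarith) hxl.le
      (hxr.trans hba) (hy.trans hε'ε) he
    refine ⟨s, ?_, y, hy, hs⟩
    by_contra! hlt
    obtain ⟨x', hx', k, -⟩ := hs' s₁ ⟨hlt.le, ht⟩
    have := (hinj (abs_lt.2 ⟨by linarith [hx'.1], by linarith [hx'.2]⟩) (hy.trans hε'ε) hab
      (hy₁.trans hε'ε) (k.symm.trans hs₁)).1
    linarith [hx'.2]
  have hVbdd : BddBelow V := ⟨s₁, fun s hs => hs.1⟩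
  set s₂ := sInf V with hs₂
  have hs₁₂ : s₁ ≤ s₂ := le_csInf hVne fun s hs => hs.1
  obtain ⟨y₂, hy₂, hs₂e⟩ : ∃ y : ℝ, |y| ≤ ε' ∧ Φ s₂ z = β ⟨-b, y⟩ := by
    have hcl : IsClosed {s : ℝ | Φ s z ∈ (fun y : ℝ => β ⟨-b, y⟩) '' Icc (-ε') ε'} := by
      refine IsClosed.preimage (hΦ.continuous z) (IsCompact.isClosed ?_)
      refine isCompact_Icc.image_of_continuousOn fun y hy => ?_
      have hmk : Continuous fun y : ℝ => (⟨-b, y⟩ : ℂ) :=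
        Complex.equivRealProdCLM.symm.continuous.comp (continuous_const.prodMk continuous_id)
      exact (ContinuousAt.comp (f := fun y : ℝ => (⟨-b, y⟩ : ℂ)) (hβ.continuousAt (v := ⟨-b, y⟩)
        hab' ((abs_le.2 hy).trans_lt hε'ε)) hmk.continuousAt).continuousWithinAt
    obtain ⟨y, hy, he⟩ := closure_minimal (fun s hs => by
      obtain ⟨-, y, hy, he⟩ := hs
      exact ⟨y, abs_le.1 hy.le, he.symm⟩) hcl (csInf_mem_closure hVne hVbdd)
    exact ⟨y, abs_le.2 hy, he.symm⟩
  -- the infimum is attained: right after a visit the trajectory is not on the left edge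
  have hy₂' : |y₂| < ε' := by
    by_contra hnot
    have hs₂V : s₂ ∉ V := by
      rintro ⟨-, y, hy, he⟩
      have := (hinj hab' (hy.trans hε'ε) hab' (hy₂.trans_lt hε'ε) (he.symm.trans hs₂e)).2
      exact hnot (this ▸ hy)
    obtain ⟨s', hs's, hs'e, hs'⟩ := hβ.exists_forward hΦ hX hPc hPX (by linarith)
      (by linarith : -b ≤ b) hba (hy₂.trans_lt hε'ε) hs₂e
    have hlt : s₂ < s' := by
      refine lt_of_le_of_ne hs's fun he => ?_
      rw [← he, hs₂e] at hs'e
      have := (hinj hab' (hy₂.trans_lt hε'ε) hab (hy₂.trans_lt hε'ε) hs'e).1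
      linarith
    obtain ⟨s, hsV, hs⟩ := exists_lt_of_csInf_lt hVne hlt
    have hs₂s : s₂ ≤ s := csInf_le hVbdd hsV
    obtain ⟨x, hx, k, -⟩ := hs' s ⟨hs₂s, hs.le⟩
    obtain ⟨-, y, hy, he⟩ := hsV
    have := (hinj (abs_lt.2 ⟨by linarith [hx.1], by linarith [hx.2]⟩) (hy₂.trans_lt hε'ε) hab'
      (hy.trans hε'ε) (k.symm.trans he)).2
    exact hnot (this ▸ hy)
  refine ⟨b, y₁, y₂, s₁, s₂, hb, hba, hy₁, hy₂', lt_of_le_of_ne hs₁₂ fun he => ?_, hs₁, hs₂e, ?_⟩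
  · rw [← he, hs₁] at hs₂e
    have := (hinj hab (hy₁.trans hε'ε) hab' (hy₂'.trans hε'ε) hs₂e).1
    linarith
  · intro s hs x y hx hy he
    have he' : Φ s z = β ⟨x, y⟩ := he
    obtain ⟨hxl, hxr⟩ := abs_le.1 hx
    obtain ⟨s', hs's, hs'e, hs'⟩ := hβ.exists_backward hΦ hX hPc hPX (by linarith) hxl
      (hxr.trans_lt hba) (hy.trans hε'ε) he'
    have hmemV : s' ∉ V := by
      intro hmem
      have hle : s₂ ≤ s' := csInf_le hVbdd hmem
      linarith [hs.2]
    have hlt : s' < s₁ := by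
      by_contra! hge
      exact hmemV ⟨hge, y, hy, hs'e⟩
    obtain ⟨x', hx', k, k'⟩ := hs' s₁ ⟨hlt.le, hs.1.le⟩
    have := (hinj (abs_lt.2 ⟨by linarith [hx'.1], by linarith [hx'.2]⟩) (hy.trans hε'ε) hab
      (hy₁.trans hε'ε) (k.symm.trans hs₁)).1
    linarith [k' hs.1]

/-- A trajectory cannot accumulate at a point that is neither a pole of `φ'` nor an equilibrium. -/
theorem not_mapClusterPt {X : ℂ → ℂ} {α q z p : ℂ} {Φ : ℝ → ℂ → ℂ} {K : ℝ≥0}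
    (hΦ : IsFlow X Φ) (hX : LipschitzWith K X) (hα : 0 < α.re) (hX0 : X 0 = 0) (hXq : X q = 0)
    (hPX : ∀ t, t ≠ 0 → t ≠ q → ∃ ρ : ℝ, 0 ≤ ρ ∧ (α / t + 1 / (t - q)) * X t = -ρ)
    (hp : X p ≠ 0) (hPp : α / p + 1 / (p - q) ≠ 0) :
    ¬ MapClusterPt p atTop fun s => Φ s z := by
  intro hcl
  have hp0 : p ≠ 0 := by rintro rfl; exact hp hX0
  have hpq : p ≠ q := by rintro rfl; exact hp hXq
  obtain ⟨β, a, ε, ha, hε, hε₀, hβ0, hβ⟩ := exists_isFlowBox hX.continuous hp0 hpq hPp hp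
    (lt_min one_pos hα)
  have hPc : ∀ t, t ≠ 0 → t ≠ q → ContinuousAt (fun t => α / t + 1 / (t - q)) t :=
    fun t h0 hq => (continuousAt_const.div continuousAt_id h0).add
      (continuousAt_const.div (continuousAt_id.sub continuousAt_const) (sub_ne_zero.2 hq))
  obtain ⟨b, y₁, y₂, s₁, s₂, hret⟩ := exists_isReturn hβ ha hε hΦ hX hPc hPX
    (by rwa [hβ0])
  have hε2 : ε / 2 ≤ ε := by linarith
  exact hret.false_of_height_le (hβ.mono hε2) hΦ hX hα hX0 hXq hPX
    (hε2.trans (hε₀.trans (min_le_left _ _))) (hε2.trans (hε₀.trans (min_le_right _ _)))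

/-! ### The descent field -/

/-- The numerator of `φ'`. -/
def phiNum (α z t : ℂ) : ℂ := α - z * t * (α + 1)

/-- The denominator of `φ'`. -/
def phiDen (z t : ℂ) : ℂ := t * (1 - z * t)

/-- The direction field `-conj (φ')` of steepest descent, multiplied by the positive function
`‖phiDen z t‖ ^ 2`, which turns it into a polynomial field in `t` and `conj t`: the poles of `φ'`
become equilibria. -/
def descentField (α z t : ℂ) : ℂ := -(conj (phiNum α z t)) * phiDen z t

theorem phiDeriv_eq (α z t : ℂ) : phiDeriv α z t = phiNum α z t / phiDen z t := rfl

section field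

variable {α z t : ℂ}

theorem add_one_ne_zero_of_re_pos (hα : 0 < α.re) : α + 1 ≠ 0 := fun h => by
  have := congrArg Complex.re h
  simp at this
  linarith

theorem re_conj_phiNum_mul (α w : ℂ) :
    (conj (α - w * (α + 1)) * (1 - w)).re = α.re * ‖1 - w‖ ^ 2 - w.re + ‖w‖ ^ 2 := by
  rw [← Complex.normSq_eq_norm_sq, ← Complex.normSq_eq_norm_sq]
  simp [Complex.normSq_apply]
  ring

theorem re_conj_mul_descentField (α z t : ℂ) :
    (conj t * descentField α z t).re =
      -(‖t‖ ^ 2 * (conj (phiNum α z t) * (1 - z * t)).re) := by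
  have : conj t * descentField α z t =
      -(((‖t‖ ^ 2 : ℝ) : ℂ) * (conj (phiNum α z t) * (1 - z * t))) := by
    rw [← Complex.normSq_eq_norm_sq, Complex.normSq_eq_conj_mul_self, descentField, phiDen]
    ring
  rw [this, Complex.neg_re, Complex.re_ofReal_mul]

/-- The field points inwards along the circles about `0` that enclose `1 / z`. -/
theorem re_conj_mul_descentField_neg (hα : 0 < α.re) (ht : 1 < ‖z‖ * ‖t‖) :
    (conj t * descentField α z t).re < 0 := by
  rw [re_conj_mul_descentField, phiNum, re_conj_phiNum_mul]
  have h1 : 1 < ‖z * t‖ := by rwa [norm_mul]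
  have h2 : (z * t).re ≤ ‖z * t‖ := Complex.re_le_norm _
  have h3 : 0 ≤ α.re * ‖1 - z * t‖ ^ 2 := by positivity
  have h4 : 0 < ‖t‖ := by
    rcases (norm_nonneg t).eq_or_lt with h | h
    · rw [← h] at ht; linarith
    · exact h
  have h5 : 0 < α.re * ‖1 - z * t‖ ^ 2 - (z * t).re + ‖z * t‖ ^ 2 := by nlinarith
  have := mul_pos (pow_pos h4 2) h5
  linarith

/-- The field points inwards along small circles about the pole `0`. -/
theorem eventually_inward_zero (hα : 0 < α.re) (z : ℂ) :
    ∀ᶠ t in 𝓝 (0 : ℂ), t ≠ 0 → (conj (t - 0) * descentField α z t).re < 0 := by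
  have hc : Continuous fun t : ℂ => (conj (phiNum α z t) * (1 - z * t)).re := by
    unfold phiNum
    exact Complex.continuous_re.comp ((Complex.continuous_conj.comp (by fun_prop)).mul (by fun_prop))
  have h0 : 0 < (conj (phiNum α z 0) * (1 - z * 0)).re := by simpa [phiNum] using hα
  filter_upwards [hc.continuousAt.eventually (lt_mem_nhds h0)] with t ht ht0
  rw [sub_zero, re_conj_mul_descentField]
  have := mul_pos (pow_pos (norm_pos_iff.2 ht0) 2) ht
  linarith

/-- The field points inwards along small circles about the pole `1 / z`. -/
theorem eventually_inward_inv (α : ℂ) (hz : z ≠ 0) :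
    ∀ᶠ t in 𝓝 (1 / z), t ≠ 1 / z → (conj (t - 1 / z) * descentField α z t).re < 0 := by
  have hc : Continuous fun t : ℂ => (conj (phiNum α z t) * (z * t)).re := by
    unfold phiNum
    exact Complex.continuous_re.comp ((Complex.continuous_conj.comp (by fun_prop)).mul (by fun_prop))
  have h0 : (conj (phiNum α z (1 / z)) * (z * (1 / z))).re < 0 := by
    simp [phiNum, mul_inv_cancel₀ hz]
  filter_upwards [hc.continuousAt.eventually (gt_mem_nhds h0)] with t ht ht0
  have : conj (t - 1 / z) * descentField α z t =
      ((‖t - 1 / z‖ ^ 2 : ℝ) : ℂ) * (conj (phiNum α z t) * (z * t)) := by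
    rw [← Complex.normSq_eq_norm_sq, Complex.normSq_eq_conj_mul_self, descentField, phiDen]
    field_simp
    ring
  rw [this, Complex.re_ofReal_mul]
  exact mul_neg_of_pos_of_neg (pow_pos (norm_pos_iff.2 (sub_ne_zero.2 ht0)) 2) ht

theorem phiDen_eq_zero_iff (hz : z ≠ 0) : phiDen z t = 0 ↔ t = 0 ∨ t = 1 / z := by
  rw [phiDen, mul_eq_zero, sub_eq_zero, eq_div_iff hz, mul_comm t z, eq_comm (a := (1 : ℂ))]

theorem phiNum_eq_zero_iff (hα : 0 < α.re) (hz : z ≠ 0) :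
    phiNum α z t = 0 ↔ t = saddlePoint α z := by
  have h1 := add_one_ne_zero_of_re_pos hα
  rw [phiNum, saddlePoint, sub_eq_zero, eq_div_iff (mul_ne_zero h1 hz)]
  constructor <;> intro h <;> linear_combination -h

theorem phiDen_saddlePoint_ne_zero (hα : 0 < α.re) (hz : z ≠ 0) :
    phiDen z (saddlePoint α z) ≠ 0 := by
  have h1 := add_one_ne_zero_of_re_pos hα
  have h0 : α ≠ 0 := by rintro rfl; simp at hα
  have : 1 - z * saddlePoint α z = 1 / (α + 1) := by
    rw [saddlePoint]
    field_simp
    ring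
  rw [phiDen, this]
  exact mul_ne_zero (div_ne_zero h0 (mul_ne_zero h1 hz)) (one_div_ne_zero h1)

theorem phiDeriv_eq_add (hz : z ≠ 0) (h0 : t ≠ 0) (h1 : t ≠ 1 / z) :
    α / t + 1 / (t - 1 / z) = phiNum α z t / phiDen z t := by
  have h2 : t * z - 1 ≠ 0 := by
    rw [sub_ne_zero]
    intro h
    exact h1 (by rw [eq_div_iff hz, h])
  have h3 : 1 - z * t ≠ 0 := by
    intro h; apply h2; linear_combination -h
  have h4 : t - 1 / z ≠ 0 := sub_ne_zero.2 h1
  rw [phiNum, phiDen]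
  have h5 : 1 - t * z ≠ 0 := by rwa [mul_comm]
  field_simp
  ring

theorem contDiff_descentField (α z : ℂ) : ContDiff ℝ 1 (descentField α z) := by
  unfold descentField phiNum phiDen
  have h1 : ContDiff ℝ 1 fun t : ℂ => conj (α - z * t * (α + 1)) :=
    Complex.conjCLE.contDiff.comp (by fun_prop)
  exact h1.neg.mul (by fun_prop)

end field

/-- A complete flow whose trajectories are, up to parametrization, curves of steepest descent, and
which in the disc of radius `R` is the flow of `descentField`. The disc contains the pole `1 / z`,
and descending trajectories do not leave it. -/
structure IsDescentFlow (α z : ℂ) (R : ℝ) (X : ℂ → ℂ) (K : ℝ≥0) (Φ : ℝ → ℂ → ℂ) : Prop where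
  isFlow : IsFlow X Φ
  lipschitz : LipschitzWith K X
  eq_field : ∀ t, ‖t‖ ≤ R → X t = descentField α z t
  exists_smul : ∀ t, ∃ c : ℝ, 0 ≤ c ∧ X t = c * descentField α z t
  one_le : 1 ≤ R
  one_lt : 1 < ‖z‖ * R

/-- Cutting off `descentField` outside a large disc makes it Lipschitz and bounded. -/
theorem exists_isDescentFlow (α : ℂ) {z : ℂ} (hz : z ≠ 0) :
    ∃ R X K Φ, IsDescentFlow α z R X K Φ := by
  have hz' : 0 < ‖z‖ := norm_pos_iff.2 hz
  set R : ℝ := 1 + 1 / ‖z‖ with hR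
  have hR1 : 1 ≤ R := by rw [hR]; linarith [div_pos one_pos hz']
  have hzR : 1 < ‖z‖ * R := by rw [hR, mul_add, mul_one_div_cancel hz'.ne']; linarith
  set χ : ContDiffBump (0 : ℂ) := ⟨R, R + 1, by linarith, by linarith⟩ with hχ
  set X : ℂ → ℂ := fun t => χ t • descentField α z t with hX
  have hXs : HasCompactSupport X := χ.hasCompactSupport.smul_right
  have hXc : ContDiff ℝ 1 X := χ.contDiff.smul (contDiff_descentField α z)
  obtain ⟨K, hK⟩ := hXc.lipschitzWith_of_hasCompactSupport hXs one_ne_zero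
  obtain ⟨M, hM⟩ := hXs.exists_bound_of_continuous hXc.continuous
  obtain ⟨Φ, hΦ⟩ := exists_isFlow hK (M := M.toNNReal) fun x => (hM x).trans (Real.le_coe_toNNReal M)
  refine ⟨R, X, K, Φ, hΦ, hK, fun t ht => ?_, fun t => ⟨χ t, χ.nonneg, ?_⟩, hR1, hzR⟩
  · have : χ t = 1 := χ.one_of_mem_closedBall (by simpa using ht)
    simp [hX, this]
  · simp [hX, Complex.real_smul]

namespace IsDescentFlow

variable {α z : ℂ} {R : ℝ} {X : ℂ → ℂ} {K : ℝ≥0} {Φ : ℝ → ℂ → ℂ}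

theorem field_zero (h : IsDescentFlow α z R X K Φ) : X 0 = 0 := by
  obtain ⟨c, -, hc⟩ := h.exists_smul 0
  simp [hc, descentField, phiDen]

theorem field_inv (h : IsDescentFlow α z R X K Φ) (hz : z ≠ 0) : X (1 / z) = 0 := by
  obtain ⟨c, -, hc⟩ := h.exists_smul (1 / z)
  rw [hc, descentField, phiDen, mul_one_div_cancel hz]
  simp

theorem field_saddlePoint (h : IsDescentFlow α z R X K Φ) (hα : 0 < α.re) (hz : z ≠ 0) :
    X (saddlePoint α z) = 0 := by
  obtain ⟨c, -, hc⟩ := h.exists_smul (saddlePoint α z)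
  rw [hc, descentField, (phiNum_eq_zero_iff hα hz).2 rfl]
  simp

theorem norm_le (h : IsDescentFlow α z R X K Φ) (hα : 0 < α.re) {x : ℂ} (hx : ‖x‖ ≤ R) {s : ℝ}
    (hs : 0 ≤ s) : ‖Φ s x‖ ≤ R := by
  have := dist_le_of_inward (ℓ := fun s => Φ s x) (ℓ' := fun s => X (Φ s x)) (a := 0) (b := s)
    (ρ := R) (c := 0) (h.isFlow.continuous x).continuousOn
    (fun t _ => (h.isFlow.hasDerivAt t x).hasDerivWithinAt) (by rwa [h.isFlow.zero, sub_zero])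
    (fun t _ ht => by
      rw [sub_zero] at ht ⊢
      rw [h.eq_field _ ht.le]
      exact re_conj_mul_descentField_neg hα (by rw [ht]; exact h.one_lt)) s (right_mem_Icc.2 hs)
  rwa [sub_zero] at this

/-- If the flow points inwards along all small circles about a point at which a trajectory
accumulates, then the trajectory converges to this point. -/
theorem tendsto_of_mapClusterPt (h : IsDescentFlow α z R X K Φ) {c x : ℂ} (hc : ‖c‖ < R)
    (hin : ∀ᶠ t in 𝓝 c, t ≠ c → (conj (t - c) * descentField α z t).re < 0)
    (hcl : MapClusterPt c atTop fun s => Φ s x) : Tendsto (fun s => Φ s x) atTop (𝓝 c) := by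
  have hR : ∀ᶠ t in 𝓝 c, ‖t‖ < R := continuous_norm.continuousAt.eventually (gt_mem_nhds hc)
  obtain ⟨r, hr, hball⟩ := Metric.eventually_nhds_iff_ball.1 (hin.and hR)
  rw [Metric.tendsto_nhds]
  intro δ hδ
  set ρ := min (r / 2) (δ / 2) with hρ
  have hρ0 : 0 < ρ := lt_min (by positivity) (by positivity)
  have hρr : ρ < r := (min_le_left _ _).trans_lt (by linarith)
  have hρδ : ρ < δ := (min_le_right _ _).trans_lt (by linarith)
  obtain ⟨s₀, -, hs₀⟩ := frequently_atTop.1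
    (mapClusterPt_iff_frequently.1 hcl _ (ball_mem_nhds c hρ0)) 0
  filter_upwards [eventually_ge_atTop s₀] with s hs
  have := dist_le_of_inward (ℓ := fun s => Φ s x) (ℓ' := fun s => X (Φ s x)) (a := s₀) (b := s)
    (ρ := ρ) (c := c) (h.isFlow.continuous x).continuousOn
    (fun t _ => (h.isFlow.hasDerivAt t x).hasDerivWithinAt)
    (by rw [← dist_eq_norm]; exact (mem_ball.1 hs₀).le)
    (fun t _ ht => by
      have hmem : Φ t x ∈ ball c r := by rw [mem_ball, dist_eq_norm, ht]; exact hρr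
      obtain ⟨k1, k2⟩ := hball _ hmem
      rw [h.eq_field _ k2.le]
      refine k1 fun he => ?_
      rw [he, sub_self, norm_zero] at ht
      exact hρ0.ne ht) s (right_mem_Icc.2 hs)
  rw [dist_eq_norm]
  exact this.trans_lt hρδ

/-- Every descending trajectory ends at one of the poles of `φ'` or at the saddle point. -/
theorem tendsto_or (h : IsDescentFlow α z R X K Φ) (hα : 0 < α.re) (hz : z ≠ 0) {x : ℂ}
    (hx : ‖x‖ ≤ R) :
    Tendsto (fun s => Φ s x) atTop (𝓝 0) ∨ Tendsto (fun s => Φ s x) atTop (𝓝 (1 / z)) ∨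
      Tendsto (fun s => Φ s x) atTop (𝓝 (saddlePoint α z)) := by
  have hz' : 0 < ‖z‖ := norm_pos_iff.2 hz
  by_cases h0 : MapClusterPt 0 atTop fun s => Φ s x
  · exact Or.inl (h.tendsto_of_mapClusterPt (by rw [norm_zero]; linarith [h.one_le])
      (eventually_inward_zero hα z) h0)
  by_cases h1 : MapClusterPt (1 / z) atTop fun s => Φ s x
  · refine Or.inr (Or.inl (h.tendsto_of_mapClusterPt ?_ (eventually_inward_inv α hz) h1))
    rw [norm_div, norm_one, div_lt_iff₀ hz', mul_comm]
    exact h.one_lt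
  refine Or.inr (Or.inr ((isCompact_closedBall (0 : ℂ) R).tendsto_nhds_of_unique_mapClusterPt
    ?_ fun y hy hcl => ?_))
  · filter_upwards [eventually_ge_atTop 0] with s hs
    rw [mem_closedBall_zero_iff]
    exact h.norm_le hα hx hs
  rw [mem_closedBall_zero_iff] at hy
  have hy0 : y ≠ 0 := by rintro rfl; exact h0 hcl
  have hy1 : y ≠ 1 / z := by rintro rfl; exact h1 hcl
  -- an accumulation point other than the poles and the saddle point is a regular point
  by_contra hne
  have hN : phiNum α z y ≠ 0 := fun he => hne ((phiNum_eq_zero_iff hα hz).1 he)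
  have hD : phiDen z y ≠ 0 := fun he => ((phiDen_eq_zero_iff hz).1 he).elim hy0 hy1
  refine not_mapClusterPt (α := α) (q := 1 / z) h.isFlow h.lipschitz hα h.field_zero
    (h.field_inv hz) (fun t ht0 ht1 => ?_) ?_ ?_ hcl
  · obtain ⟨c, hc, hce⟩ := h.exists_smul t
    have hDt : phiDen z t ≠ 0 := fun he => ((phiDen_eq_zero_iff hz).1 he).elim ht0 ht1
    refine ⟨c * ‖phiNum α z t‖ ^ 2, by positivity, ?_⟩
    rw [phiDeriv_eq_add hz ht0 ht1, hce, descentField, ← Complex.normSq_eq_norm_sq]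
    push_cast
    rw [Complex.normSq_eq_conj_mul_self]
    field_simp
  · rw [h.eq_field _ hy, descentField]
    exact mul_ne_zero (neg_ne_zero.2 ((map_ne_zero _).2 hN)) hD
  · rw [phiDeriv_eq_add hz hy0 hy1]
    exact div_ne_zero hN hD

end IsDescentFlow

/-! ### Functions on a half-line with a limit at infinity -/

theorem exists_pos_forall_le_of_tendsto {f : ℝ → ℝ} {L : ℝ} (hf : ContinuousOn f (Ici 0))
    (hpos : ∀ s ∈ Ici (0 : ℝ), 0 < f s) (hL : 0 < L) (hlim : Tendsto f atTop (𝓝 L)) :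
    ∃ m, 0 < m ∧ ∀ s ∈ Ici (0 : ℝ), m ≤ f s := by
  obtain ⟨T, hT⟩ := eventually_atTop.1 (hlim.eventually (lt_mem_nhds (half_lt_self hL)))
  set T' := max T 0
  obtain ⟨s₀, hs₀, hmin⟩ := (isCompact_Icc (a := (0 : ℝ)) (b := T')).exists_isMinOn
    ⟨0, left_mem_Icc.2 (le_max_right _ _)⟩ (hf.mono fun s hs => hs.1)
  refine ⟨min (f s₀) (L / 2), lt_min (hpos _ hs₀.1) (half_pos hL), fun s hs => ?_⟩
  rcases le_or_gt s T' with h | h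
  · exact (min_le_left _ _).trans (hmin ⟨hs, h⟩)
  · exact (min_le_right _ _).trans (hT s ((le_max_left _ _).trans h.le)).le

theorem exists_forall_norm_le_of_tendsto {f : ℝ → ℂ} {L : ℂ} (hf : ContinuousOn f (Ici 0))
    (hlim : Tendsto f atTop (𝓝 L)) : ∃ M, ∀ s ∈ Ici (0 : ℝ), ‖f s‖ ≤ M := by
  have hpos : ∀ a : ℂ, 0 < (1 + ‖a‖)⁻¹ := fun a => by positivity
  obtain ⟨m, hm, hmf⟩ := exists_pos_forall_le_of_tendsto (f := fun s => (1 + ‖f s‖)⁻¹)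
    ((continuousOn_const.add hf.norm).inv₀ fun s _ =>
      (by positivity : (0 : ℝ) < 1 + ‖f s‖).ne')
    (fun s _ => hpos _) (hpos L)
    ((tendsto_const_nhds.add hlim.norm).inv₀ (by positivity : (0 : ℝ) < 1 + ‖L‖).ne')
  refine ⟨m⁻¹, fun s hs => ?_⟩
  have := (le_inv_comm₀ hm (by positivity)).1 (hmf s hs)
  linarith

/-! ### The paths of steepest ascent from the saddle point -/

namespace IsDescentFlow

variable {α z : ℂ} {R : ℝ} {X : ℂ → ℂ} {K : ℝ≥0} {Φ : ℝ → ℂ → ℂ}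

/-- A point from which the flow descends to the saddle point lies on a path of steepest ascent from
the saddle point: reverse the trajectory and parametrize it by the time of the gradient flow. -/
theorem mem_ascentCurves (h : IsDescentFlow α z R X K Φ) (hα : 0 < α.re) (hz : z ≠ 0) {x : ℂ}
    (hx : ‖x‖ ≤ R) (hlim : Tendsto (fun s => Φ s x) atTop (𝓝 (saddlePoint α z))) :
    x ∈ ascentCurves α z := by
  have hDt₀ := phiDen_saddlePoint_ne_zero hα hz
  have hDc : Continuous (phiDen z) := by unfold phiDen; fun_prop
  have hne : ∀ {p}, X p = 0 → phiDen z p = 0 → ∀ s, Φ s x ≠ p := by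
    intro p hp hDp s he
    have hconst : ∀ t, Φ t x = p := h.isFlow.eq_of_mem_equilibrium h.lipschitz hp he
    simp only [hconst] at hlim
    rw [tendsto_nhds_unique tendsto_const_nhds hlim] at hDp
    exact hDt₀ hDp
  have hne0 : ∀ s, Φ s x ≠ 0 := hne h.field_zero ((phiDen_eq_zero_iff hz).2 (Or.inl rfl))
  have hne1 : ∀ s, Φ s x ≠ 1 / z :=
    hne (h.field_inv hz) ((phiDen_eq_zero_iff hz).2 (Or.inr rfl))
  have hD : ∀ s, phiDen z (Φ s x) ≠ 0 := fun s he =>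
    ((phiDen_eq_zero_iff hz).1 he).elim (hne0 s) (hne1 s)
  have hΦc := h.isFlow.continuous x
  -- the density of gradient time, extended evenly to negative times
  set F : ℝ → ℝ := fun τ => ‖phiDen z (Φ |τ| x)‖ ^ 2 with hF
  have hFc : Continuous F := (hDc.comp (hΦc.comp continuous_abs)).norm.pow 2
  obtain ⟨m, hm, hmF⟩ := exists_pos_forall_le_of_tendsto
    (f := fun s => ‖phiDen z (Φ s x)‖ ^ 2) ((hDc.comp hΦc).norm.pow 2).continuousOn
    (fun s _ => pow_pos (norm_pos_iff.2 (hD s)) 2) (pow_pos (norm_pos_iff.2 hDt₀) 2)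
    (((hDc.tendsto _).comp hlim).norm.pow 2)
  have hmF' : ∀ τ, m ≤ F τ := fun τ => hmF |τ| (abs_nonneg τ)
  set θ : ℝ → ℝ := fun τ => ∫ y in (0 : ℝ)..τ, F y with hθ
  have hθ' : ∀ τ, HasDerivAt θ (F τ) τ := fun τ =>
    intervalIntegral.integral_hasDerivAt_right (hFc.intervalIntegrable _ _)
      (hFc.stronglyMeasurableAtFilter _ _) hFc.continuousAt
  have hθc : Continuous θ := continuous_iff_continuousAt.2 fun τ => (hθ' τ).continuousAt
  have hθ0 : θ 0 = 0 := by simp [hθ]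
  have hmono : Monotone fun τ => θ τ - m * τ := by
    have hd : ∀ τ, HasDerivAt (fun τ => θ τ - m * τ) (F τ - m * 1) τ := fun τ =>
      (hθ' τ).sub ((hasDerivAt_id' τ).const_mul m)
    refine monotone_of_deriv_nonneg (fun τ => (hd τ).differentiableAt) fun τ => ?_
    rw [(hd τ).deriv]
    linarith [hmF' τ]
  have hθmono : StrictMono θ := fun s t hst => by
    have := hmono hst.le
    have h2 := mul_lt_mul_of_pos_left hst hm
    simp only at this
    linarith
  have htop : Tendsto θ atTop atTop := by
    refine tendsto_atTop_mono' _ ?_ (tendsto_id.const_mul_atTop hm)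
    filter_upwards [eventually_ge_atTop 0] with τ hτ
    have := hmono hτ
    simp only [hθ0, id] at this ⊢
    linarith
  have hbot : Tendsto θ atBot atBot := by
    refine tendsto_atBot_mono' _ ?_ (tendsto_id.const_mul_atBot hm)
    filter_upwards [eventually_le_atBot 0] with τ hτ
    have := hmono hτ
    simp only [hθ0, id] at this ⊢
    linarith
  set e : ℝ ≃o ℝ := hθmono.orderIsoOfSurjective θ (hθc.surjective htop hbot) with he
  have heθ : ∀ τ, e τ = θ τ := fun τ => rfl
  have hes : ∀ s, θ (e.symm s) = s := fun s => by rw [← heθ, e.apply_symm_apply]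
  have hes0 : e.symm 0 = 0 := by
    rw [e.symm_apply_eq, heθ, hθ0]
  have hes' : ∀ s, HasDerivAt e.symm (F (e.symm s))⁻¹ s := fun s =>
    HasDerivAt.of_local_left_inverse e.symm.continuous.continuousAt (hθ' _)
      (hm.trans_le (hmF' _)).ne' (Eventually.of_forall hes)
  refine ⟨fun s => Φ (e.symm (-s)) x, fun s hs => ⟨hne0 _, hne1 _, ?_⟩, ?_, ?_⟩
  · set τ := e.symm (-s) with hτ
    have hτ0 : 0 ≤ τ := by
      rw [← hes0, hτ]; exact e.symm.monotone (by linarith)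
    have h1 : HasDerivAt (fun s => e.symm (-s)) (-(F τ)⁻¹) s := by
      have := (hes' (-s)).comp s (hasDerivAt_neg s)
      simpa [Function.comp_def] using this
    have h2 := (h.isFlow.hasDerivAt τ x).scomp s h1
    refine HasDerivAt.hasDerivWithinAt ?_
    convert! h2 using 1
    change conj (phiDeriv α z (Φ τ x)) = -(F τ)⁻¹ • X (Φ τ x)
    rw [h.eq_field _ (h.norm_le hα hx hτ0), Complex.real_smul, descentField, phiDeriv_eq, map_div₀]
    simp only [hF, abs_of_nonneg hτ0, ← Complex.normSq_eq_norm_sq]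
    push_cast
    rw [Complex.normSq_eq_conj_mul_self]
    have hDτ := hD τ
    have hDτ' : conj (phiDen z (Φ τ x)) ≠ 0 := (map_ne_zero _).2 hDτ
    field_simp
  · exact hlim.comp (e.symm.tendsto_atTop.comp tendsto_neg_atBot_atTop)
  · simp only [neg_zero, hes0, h.isFlow.zero]

/-- A point on a path of steepest ascent from the saddle point cannot descend to any other point. -/
theorem eq_saddlePoint_of_mem_ascentCurves (h : IsDescentFlow α z R X K Φ) (hα : 0 < α.re)
    (hz : z ≠ 0) {x y : ℂ} (hx : ‖x‖ ≤ R) (hmem : x ∈ ascentCurves α z)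
    (hlim : Tendsto (fun s => Φ s x) atTop (𝓝 y)) : y = saddlePoint α z := by
  obtain ⟨γ, hγ, hγlim, hγ0⟩ := hmem
  have hDc : Continuous (phiDen z) := by unfold phiDen; fun_prop
  set ℓ : ℝ → ℂ := fun u => γ (-u) with hℓ
  have hD : ∀ u, 0 ≤ u → phiDen z (ℓ u) ≠ 0 := fun u hu he =>
    ((phiDen_eq_zero_iff hz).1 he).elim (hγ (-u) (by linarith)).1 (hγ (-u) (by linarith)).2.1
  set r : ℝ → ℝ := fun u => (‖phiDen z (ℓ u)‖ ^ 2)⁻¹ with hr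
  have hr0 : ∀ u, 0 ≤ u → 0 < r u := fun u hu =>
    inv_pos.2 (pow_pos (norm_pos_iff.2 (hD u hu)) 2)
  have hγc : ContinuousOn γ (Iic 0) := fun s hs => (hγ s hs).2.2.continuousWithinAt
  have hℓc : ContinuousOn ℓ (Ici 0) :=
    hγc.comp continuousOn_neg fun u hu => by simpa using hu
  have hℓ' : ∀ u, 0 ≤ u → HasDerivWithinAt ℓ (r u • descentField α z (ℓ u)) (Ici u) u := by
    intro u hu
    have h1 := (hγ (-u) (by linarith)).2.2.scomp u (hasDerivAt_neg u).hasDerivWithinAt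
      (s := Ici u) fun v hv => by
        have hv' : u ≤ v := hv
        exact (by linarith : -v ≤ 0)
    convert! h1 using 1
    rw [phiDeriv_eq, map_div₀, Complex.real_smul, descentField]
    simp only [hr, ← Complex.normSq_eq_norm_sq]
    push_cast
    rw [Complex.normSq_eq_conj_mul_self]
    have hDτ : phiDen z (γ (-u)) ≠ 0 := hD u hu
    have hDτ' : conj (phiDen z (γ (-u))) ≠ 0 := (map_ne_zero _).2 hDτ
    simp only [hℓ]
    rw [Complex.real_smul]
    field_simp
    simp
  have hℓ0 : ℓ 0 = x := by simp [hℓ, hγ0]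
  have hbound : ∀ u, 0 ≤ u → ‖ℓ u‖ ≤ R := by
    intro u hu
    have := dist_le_of_inward (a := 0) (b := u) (ρ := R) (c := 0) (hℓc.mono fun v hv => hv.1)
      (fun v hv => hℓ' v hv.1) (by rwa [hℓ0, sub_zero]) (fun v hv hvR => by
        rw [sub_zero] at hvR ⊢
        have hneg := re_conj_mul_descentField_neg (z := z) (t := ℓ v) hα
          (by rw [hvR]; exact h.one_lt)
        have : conj (ℓ v) * r v • descentField α z (ℓ v) =
            (r v : ℂ) * (conj (ℓ v) * descentField α z (ℓ v)) := by
          rw [Complex.real_smul]; ring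
        rw [this, Complex.re_ofReal_mul]
        exact mul_neg_of_pos_of_neg (hr0 v hv.1) hneg) u (right_mem_Icc.2 hu)
    rwa [sub_zero] at this
  have hrc : ContinuousOn r (Ici 0) := by
    refine ContinuousOn.inv₀ ((hDc.comp_continuousOn hℓc).norm.pow 2) fun u hu => ?_
    exact (pow_pos (norm_pos_iff.2 (hD u hu)) 2).ne'
  set σ : ℝ → ℝ := fun u => ∫ v in (0 : ℝ)..u, r v with hσ
  have hrep : ∀ u, 0 ≤ u → ℓ u = Φ (σ u) x := by
    intro u hu
    have := h.isFlow.eq_comp_integral h.lipschitz (hrc.mono fun v hv => hv.1)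
      (hℓc.mono fun v hv => hv.1) (a := 0) (b := u) (fun v hv => by
        rw [h.eq_field _ (hbound v hv.1)]; exact hℓ' v hv.1) u (right_mem_Icc.2 hu)
    rwa [hℓ0] at this
  obtain ⟨M, hM⟩ := ((isCompact_closedBall (0 : ℂ) R).image hDc).isBounded.exists_norm_le
  have hM0 : 0 < M := by
    refine (norm_pos_iff.2 (hD 0 le_rfl)).trans_le (hM _ ⟨ℓ 0, ?_, rfl⟩)
    rw [mem_closedBall_zero_iff]; exact hbound 0 le_rfl
  have hrM : ∀ u, 0 ≤ u → (M ^ 2)⁻¹ ≤ r u := by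
    intro u hu
    refine inv_anti₀ (pow_pos (norm_pos_iff.2 (hD u hu)) 2) ?_
    exact pow_le_pow_left₀ (norm_nonneg _)
      (hM _ ⟨ℓ u, by rw [mem_closedBall_zero_iff]; exact hbound u hu, rfl⟩) 2
  have hσtop : Tendsto σ atTop atTop := by
    have h1 : Tendsto (fun u : ℝ => (M ^ 2)⁻¹ * u) atTop atTop :=
      tendsto_id.const_mul_atTop (inv_pos.2 (pow_pos hM0 2))
    refine tendsto_atTop_mono' _ ?_ h1
    filter_upwards [eventually_ge_atTop 0] with u hu
    have hint : IntervalIntegrable r volume 0 u := by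
      refine ContinuousOn.intervalIntegrable ?_
      rw [uIcc_of_le hu]
      exact hrc.mono fun v hv => hv.1
    have := intervalIntegral.integral_mono_on hu (intervalIntegrable_const (c := (M ^ 2)⁻¹)) hint
      fun v hv => hrM v hv.1
    rw [intervalIntegral.integral_const, smul_eq_mul] at this
    linarith
  refine tendsto_nhds_unique ((hlim.comp hσtop).congr' ?_)
    (hγlim.comp tendsto_neg_atTop_atBot)
  filter_upwards [eventually_ge_atTop 0] with u hu
  exact (hrep u hu).symm

/-- Outside the region `E`, the path of steepest descent from `1` leads to `0`. -/
theorem tendsto_zero_of_notMem_regionE (h : IsDescentFlow α z R X K Φ) (hα : 0 < α.re) (hz : z ≠ 0)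
    (hE : z ∉ regionE α) : Tendsto (fun s => Φ s 1) atTop (𝓝 0) := by
  have hR : ‖(1 : ℂ)‖ ≤ R := by rw [norm_one]; exact h.one_le
  have h1 : (1 : ℂ) ∉ closedRegion α z (1 / z) := fun hmem => hE ⟨hz, hmem⟩
  rw [closedRegion, mem_union, not_or] at h1
  rcases h.tendsto_or hα hz hR with hlim | hlim | hlim
  · exact hlim
  · exfalso
    have hqt : 1 / z ≠ saddlePoint α z := fun he =>
      phiDen_saddlePoint_ne_zero hα hz ((phiDen_eq_zero_iff hz).2 (Or.inr he.symm))
    set G : Set ℂ := (fun s => Φ s 1) '' Ici 0 with hG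
    have hGp : IsPreconnected G := isPreconnected_Ici.image _ (h.isFlow.continuous 1).continuousOn
    have hcl : 1 / z ∈ closure G := by
      refine mem_closure_of_tendsto hlim ?_
      filter_upwards [eventually_ge_atTop 0] with s hs
      exact ⟨s, hs, rfl⟩
    have hG' : IsPreconnected (insert (1 / z) G) :=
      hGp.subset_closure (subset_insert _ _) (insert_subset hcl subset_closure)
    have hsub : insert (1 / z) G ⊆ (ascentCurves α z)ᶜ := by
      rintro t (rfl | ⟨s, hs, rfl⟩) hmem
      · obtain ⟨γ, hγ, -, hγ0⟩ := hmem
        exact (hγ 0 le_rfl).2.1 hγ0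
      · refine hqt (h.eq_saddlePoint_of_mem_ascentCurves hα hz (h.norm_le hα hR hs) hmem ?_)
        have : Tendsto (fun u => Φ (u + s) 1) atTop (𝓝 (1 / z)) :=
          hlim.comp (tendsto_atTop_add_const_right _ s tendsto_id)
        exact this.congr fun u => h.isFlow.add h.lipschitz u s 1
    -- the trajectory joins `1` to `1 / z` without meeting the paths of steepest ascent
    refine h1.1 (hG'.subset_connectedComponentIn (mem_insert _ _) hsub (Or.inr ⟨0, ?_, ?_⟩))
    · exact self_mem_Ici
    · exact h.isFlow.zero 1
  · exact absurd (h.mem_ascentCurves hα hz hR hlim) h1.2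

end IsDescentFlow

/-! ### The polynomials as integrals along a descending path -/

/-- The sum `∑ (n choose k) (-w)^k / (αn + 1 + k) = ∫₀¹ t ^ (αn) (1 - w t) ^ n dt`. -/
noncomputable def binomialSum (α : ℂ) (n : ℕ) (w : ℂ) : ℂ :=
  ∑ k ∈ Finset.range (n + 1), (n.choose k : ℂ) * (-w) ^ k / (α * n + 1 + k)

theorem mul_add_ne_zero {α : ℂ} (hα : 0 < α.re) (n k : ℕ) : α * n + 1 + k ≠ 0 := by
  intro h
  have h1 := congrArg Complex.re h
  simp at h1
  have : 0 ≤ α.re * n := by positivity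
  have : (0 : ℝ) ≤ k := by positivity
  linarith

theorem hypPoly_eq {α : ℂ} (hα : 0 < α.re) (n : ℕ) (w : ℂ) :
    hypPoly α n w = (α * n + 1) * binomialSum α n w := by
  have hb0 : α * n + 1 ≠ 0 := by simpa using mul_add_ne_zero hα n 0
  rw [hypPoly, ordinaryHypergeometric_eq_tsum, binomialSum, Finset.mul_sum]
  simp only
  rw [tsum_eq_sum (s := Finset.range (n + 1)) fun k hk => ?_]
  · refine Finset.sum_congr rfl fun k _ => ?_
    set b := α * n + 1 with hb
    have hc : α * n + 2 = b + 1 := by rw [hb]; ring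
    have h1 : (ascPochhammer ℂ k).eval b * (b + k) = b * (ascPochhammer ℂ k).eval (b + 1) := by
      rw [← ascPochhammer_succ_eval, ascPochhammer_succ_left]
      simp [Polynomial.eval_comp]
    have h2 : (ascPochhammer ℂ k).eval (b + 1) ≠ 0 := by
      rw [Ne, ascPochhammer_eval_eq_zero_iff]
      rintro ⟨j, -, hj⟩
      apply mul_add_ne_zero hα n (j + 1)
      push_cast
      rw [← hb, hj]
      ring
    have h3 : (ascPochhammer ℂ k).eval (-(n : ℂ)) = (-1) ^ k * (n.descFactorial k : ℂ) := by
      rw [ascPochhammer_eval_neg_eq_descPochhammer, descPochhammer_eval_eq_descFactorial]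
    have h4 : (n.descFactorial k : ℂ) = (k.factorial : ℂ) * (n.choose k : ℂ) := by
      exact_mod_cast Nat.descFactorial_eq_factorial_mul_choose n k
    have h5 : (k.factorial : ℂ) ≠ 0 := by exact_mod_cast k.factorial_ne_zero
    have h6 : b + k ≠ 0 := mul_add_ne_zero hα n k
    rw [hc, h3, h4, smul_eq_mul, eq_div_of_mul_eq h6 h1, neg_pow w]
    field_simp
  · rw [Finset.mem_range, not_lt] at hk
    rw [ascPochhammer_eval_neg_coe_nat_of_lt (by omega)]
    simp

/-- A curve of steepest descent from `1` to `0`. -/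
structure IsDescentToZero (α z : ℂ) (γ : ℝ → ℂ) : Prop where
  zero : γ 0 = 1
  hasDerivAt : ∀ s, 0 ≤ s → HasDerivAt γ (descentField α z (γ s)) s
  tendsto : Tendsto γ atTop (𝓝 0)
  phiNum_ne_zero : ∀ s, 0 ≤ s → phiNum α z (γ s) ≠ 0
  ne_one : z ≠ 1

namespace IsDescentToZero

variable {α z : ℂ} {γ : ℝ → ℂ}

theorem continuousAt (h : IsDescentToZero α z γ) {s : ℝ} (hs : 0 ≤ s) : ContinuousAt γ s :=
  (h.hasDerivAt s hs).continuousAt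

theorem continuousOn (h : IsDescentToZero α z γ) : ContinuousOn γ (Ici 0) := fun _ hs =>
  (h.continuousAt hs).continuousWithinAt

theorem continuous_abs (h : IsDescentToZero α z γ) : Continuous fun s => γ |s| :=
  h.continuousOn.comp_continuous _root_.continuous_abs fun s => abs_nonneg s

/-- Along the curve there are a logarithm `u` of `γ`, and a function `Q`, the decrease of `Re φ`,
such that `φ`, expressed through `u`, is `log (1 - z) - Q`. -/
theorem exists_log (h : IsDescentToZero α z γ) : ∃ (u : ℝ → ℂ) (Q : ℝ → ℝ), u 0 = 0 ∧ Q 0 = 0 ∧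
    (∀ s, 0 ≤ s → HasDerivAt u (-(conj (phiNum α z (γ s))) * (1 - z * γ s)) s) ∧
    (∀ s, 0 ≤ s → HasDerivAt Q (‖phiNum α z (γ s)‖ ^ 2) s) ∧
    (∀ s, 0 ≤ s → Complex.exp (u s) = γ s) ∧
    ∀ s, 0 ≤ s → Complex.exp (α * u s) * (1 - z * γ s) = (1 - z) * Complex.exp (-(Q s : ℂ)) := by
  have hNc : Continuous (phiNum α z) := by unfold phiNum; fun_prop
  set lam : ℝ → ℂ := fun s => -(conj (phiNum α z (γ |s|))) * (1 - z * γ |s|) with hlam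
  set ν : ℝ → ℝ := fun s => ‖phiNum α z (γ |s|)‖ ^ 2 with hν
  have hNγ : Continuous fun s => phiNum α z (γ |s|) := hNc.comp h.continuous_abs
  have hlamc : Continuous lam :=
    (Complex.continuous_conj.comp hNγ).neg.mul
      (continuous_const.sub (continuous_const.mul h.continuous_abs))
  have hνc : Continuous ν := hNγ.norm.pow 2
  set u : ℝ → ℂ := fun s => ∫ r in (0 : ℝ)..s, lam r with hu
  set Q : ℝ → ℝ := fun s => ∫ r in (0 : ℝ)..s, ν r with hQ
  have hu' : ∀ s, HasDerivAt u (lam s) s := fun s =>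
    intervalIntegral.integral_hasDerivAt_right (hlamc.intervalIntegrable _ _)
      (hlamc.stronglyMeasurableAtFilter _ _) hlamc.continuousAt
  have hQ' : ∀ s, HasDerivAt Q (ν s) s := fun s =>
    intervalIntegral.integral_hasDerivAt_right (hνc.intervalIntegrable _ _)
      (hνc.stronglyMeasurableAtFilter _ _) hνc.continuousAt
  have hlams : ∀ s, 0 ≤ s → lam s = -(conj (phiNum α z (γ s))) * (1 - z * γ s) := fun s hs => by
    simp only [hlam, abs_of_nonneg hs]
  have hνs : ∀ s, 0 ≤ s → ν s = ‖phiNum α z (γ s)‖ ^ 2 := fun s hs => by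
    simp only [hν, abs_of_nonneg hs]
  have hγ' : ∀ s, 0 ≤ s → HasDerivAt γ (lam s * γ s) s := fun s hs => by
    convert! h.hasDerivAt s hs using 1
    rw [hlams s hs, descentField, phiDen]
    ring
  have hexp : ∀ s, 0 ≤ s → Complex.exp (u s) = γ s := by
    intro s hs
    have := eq_exp_integral_mul (h := γ) (f := lam) hs hlamc.continuousOn
      (h.continuousOn.mono fun r hr => hr.1) fun r hr => (hγ' r hr.1).hasDerivWithinAt
    rw [h.zero, mul_one] at this
    exact this.symm
  refine ⟨u, Q, by simp [hu], by simp [hQ], fun s hs => hlams s hs ▸ hu' s,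
    fun s hs => hνs s hs ▸ hQ' s, hexp, fun s hs => ?_⟩
  have hf : ∀ r, 0 ≤ r → HasDerivAt (fun r => Complex.exp (α * u r) * (1 - z * γ r))
      (-(ν r : ℂ) * (Complex.exp (α * u r) * (1 - z * γ r))) r := by
    intro r hr
    have e1 := ((hu' r).const_mul α).cexp
    have e2 := ((hγ' r hr).const_mul z).const_sub 1
    convert! e1.mul e2 using 1
    rw [hνs r hr, hlams r hr, ← Complex.normSq_eq_norm_sq, Complex.normSq_eq_conj_mul_self]
    nth_rewrite 2 [phiNum]
    ring
  have hfc : ContinuousOn (fun r => Complex.exp (α * u r) * (1 - z * γ r)) (Icc 0 s) :=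
    HasDerivAt.continuousOn fun r hr => hf r hr.1
  have := eq_exp_integral_mul (f := fun r => -(ν r : ℂ)) hs
    (Complex.continuous_ofReal.comp hνc).neg.continuousOn hfc
    fun r hr => (hf r hr.1).hasDerivWithinAt
  rw [this, intervalIntegral.integral_neg, intervalIntegral.integral_ofReal]
  simp only [hu, hQ, intervalIntegral.integral_same, mul_zero, Complex.exp_zero, one_mul, h.zero,
    mul_one]
  ring

/-- The substitution of the descending path into the integral for the polynomial; the integrand has
an elementary primitive in terms of `u`, so no contour has to be deformed. -/
theorem integral_eq (h : IsDescentToZero α z γ) (hα : 0 < α.re) {u : ℝ → ℂ} (hu0 : u 0 = 0)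
    (hu : ∀ s, 0 ≤ s → HasDerivAt u (-(conj (phiNum α z (γ s))) * (1 - z * γ s)) s)
    (hexp : ∀ s, 0 ≤ s → Complex.exp (u s) = γ s)
    (hlim : Tendsto (fun s => Complex.exp (α * u s)) atTop (𝓝 0)) (n : ℕ) (w : ℂ)
    (hint : IntegrableOn (fun s => (Complex.exp (α * u s) * (1 - w * γ s)) ^ n *
      descentField α z (γ s)) (Ioi 0)) :
    ∫ s in Ioi (0 : ℝ), (Complex.exp (α * u s) * (1 - w * γ s)) ^ n * descentField α z (γ s) =
      -binomialSum α n w := by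
  have hsplit : ∀ (k : ℕ) (s : ℝ), Complex.exp ((α * n + 1 + k) * u s) =
      Complex.exp (α * u s) ^ n * Complex.exp (u s) * Complex.exp (u s) ^ k := by
    intro k s
    rw [← Complex.exp_nat_mul, ← Complex.exp_nat_mul, ← Complex.exp_add, ← Complex.exp_add]
    congr 1
    ring
  set p : ℝ → ℂ := fun s => ∑ k ∈ Finset.range (n + 1),
    (n.choose k : ℂ) * (-w) ^ k / (α * n + 1 + k) * Complex.exp ((α * n + 1 + k) * u s) with hp
  have hp' : ∀ s ∈ Ici (0 : ℝ), HasDerivAt p ((Complex.exp (α * u s) * (1 - w * γ s)) ^ n *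
      descentField α z (γ s)) s := by
    intro s hs
    have h1 : HasDerivAt p (∑ k ∈ Finset.range (n + 1),
        (n.choose k : ℂ) * (-w) ^ k / (α * n + 1 + k) *
          (Complex.exp ((α * n + 1 + k) * u s) *
            ((α * n + 1 + k) * (-(conj (phiNum α z (γ s))) * (1 - z * γ s))))) s :=
      HasDerivAt.fun_sum fun k _ => (((hu s hs).const_mul _).cexp).const_mul _
    convert! h1 using 1
    have hbin : (1 - w * γ s) ^ n =
        ∑ k ∈ Finset.range (n + 1), (n.choose k : ℂ) * (-w) ^ k * γ s ^ k := by
      rw [show 1 - w * γ s = -w * γ s + 1 by ring, add_pow]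
      refine Finset.sum_congr rfl fun k _ => ?_
      rw [mul_pow, one_pow]
      ring
    rw [mul_pow, hbin, Finset.mul_sum, Finset.sum_mul]
    refine Finset.sum_congr rfl fun k _ => ?_
    have hk := mul_add_ne_zero hα n k
    rw [hsplit, hexp s hs, descentField, phiDen]
    field_simp
  have hp0 : p 0 = binomialSum α n w := by
    simp [hp, hu0, binomialSum]
  have hplim : Tendsto p atTop (𝓝 0) := by
    have : Tendsto p atTop (𝓝 (∑ k ∈ Finset.range (n + 1),
        (n.choose k : ℂ) * (-w) ^ k / (α * n + 1 + k) * (0 ^ n * 0 * 0 ^ k))) := by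
      refine tendsto_finsetSum _ fun k _ => Tendsto.const_mul _ ?_
      simp only [hsplit]
      have hul : Tendsto (fun s => Complex.exp (u s)) atTop (𝓝 0) :=
        h.tendsto.congr' (by
          filter_upwards [eventually_ge_atTop 0] with s hs
          exact (hexp s hs).symm)
      exact ((hlim.pow n).mul hul).mul (hul.pow k)
    simpa using this
  rw [integral_Ioi_of_hasDerivAt_of_tendsto' hp' hint hplim, hp0, zero_sub]

end IsDescentToZero

/-! ### Asymptotics of the integrals -/

theorem norm_one_add_pow_sub_one_le (ε : ℂ) (n : ℕ) :
    ‖(1 + ε) ^ n - 1‖ ≤ Real.exp (n * ‖ε‖) - 1 := by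
  have h : ‖(1 + ε) ^ n - 1‖ ≤ (1 + ‖ε‖) ^ n - 1 := by
    induction n with
    | zero => simp
    | succ n ih =>
      have h1 : ‖1 + ε‖ ≤ 1 + ‖ε‖ := by simpa using norm_add_le (1 : ℂ) ε
      calc ‖(1 + ε) ^ (n + 1) - 1‖ = ‖(1 + ε) * ((1 + ε) ^ n - 1) + ε‖ := by congr 1; ring
        _ ≤ ‖1 + ε‖ * ‖(1 + ε) ^ n - 1‖ + ‖ε‖ := by
          rw [← norm_mul]; exact norm_add_le _ _
        _ ≤ (1 + ‖ε‖) * ((1 + ‖ε‖) ^ n - 1) + ‖ε‖ := by gcongr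
        _ = (1 + ‖ε‖) ^ (n + 1) - 1 := by ring
  refine h.trans (sub_le_sub_right ?_ 1)
  rw [Real.exp_nat_mul]
  refine pow_le_pow_left₀ (by positivity) ?_ n
  rw [add_comm]
  exact Real.add_one_le_exp _

namespace IsDescentToZero

variable {α z : ℂ} {γ : ℝ → ℂ}

/-- Laplace's method. For `w` near `z`, the integrand on the path descending for `z` still decreases
exponentially, and its `n`-th power concentrates at the end point `1`, where the velocity of the
path does not vanish. -/
theorem not_tendsto_zeros (h : IsDescentToZero α z γ) (hα : 0 < α.re) :
    ¬ ∃ (k : ℕ → ℕ) (w : ℕ → ℂ), StrictMono k ∧ (∀ j, hypPoly α (k j) (w j) = 0) ∧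
      Tendsto w atTop (𝓝 z) := by
  rintro ⟨k, w, hk, hzero, hw⟩
  obtain ⟨u, Q, hu0, hQ0, hu, hQ, hexp, hprod⟩ := h.exists_log
  have hNc : Continuous (phiNum α z) := by unfold phiNum; fun_prop
  have hα0 : α ≠ 0 := by rintro rfl; simp at hα
  have hz1 : 1 - z ≠ 0 := sub_ne_zero.2 h.ne_one.symm
  set c : ℝ := ‖phiNum α z 1‖ ^ 2 with hc
  have hN1 : phiNum α z 1 ≠ 0 := by simpa [h.zero] using h.phiNum_ne_zero 0 le_rfl
  have hc0 : 0 < c := pow_pos (norm_pos_iff.2 hN1) 2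
  set G : ℝ → ℂ := fun s => descentField α z (γ s) with hG
  have hVc : Continuous (descentField α z) := (contDiff_descentField α z).continuous
  have hGc : ContinuousOn G (Ici 0) := hVc.comp_continuousOn h.continuousOn
  have hG0 : G 0 ≠ 0 := by
    simp only [hG, h.zero, descentField, phiDen, mul_one, one_mul]
    exact mul_ne_zero (neg_ne_zero.2 ((map_ne_zero _).2 hN1)) hz1
  obtain ⟨m, hm, hmN⟩ := exists_pos_forall_le_of_tendsto
    (f := fun s => ‖phiNum α z (γ s)‖ ^ 2) ((hNc.comp_continuousOn h.continuousOn).norm.pow 2)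
    (fun s hs => pow_pos (norm_pos_iff.2 (h.phiNum_ne_zero s hs)) 2)
    (L := ‖phiNum α z 0‖ ^ 2) (pow_pos (norm_pos_iff.2 (by simpa [phiNum] using hα0)) 2)
    (((hNc.tendsto 0).comp h.tendsto).norm.pow 2)
  have hne : ∀ s, 0 ≤ s → 1 - z * γ s ≠ 0 := fun s hs he => by
    have := hprod s hs
    rw [he, mul_zero] at this
    exact mul_ne_zero hz1 (Complex.exp_ne_zero _) this.symm
  have hdc : ContinuousOn (fun s => 1 - z * γ s) (Ici 0) :=
    continuousOn_const.sub (continuousOn_const.mul h.continuousOn)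
  have hdlim : Tendsto (fun s => 1 - z * γ s) atTop (𝓝 1) := by
    simpa using (h.tendsto.const_mul z).const_sub 1
  obtain ⟨d, hd, hdγ⟩ := exists_pos_forall_le_of_tendsto (f := fun s => ‖1 - z * γ s‖) hdc.norm
    (fun s hs => norm_pos_iff.2 (hne s hs)) (L := 1) one_pos (by simpa using hdlim.norm)
  obtain ⟨M, hM⟩ := exists_forall_norm_le_of_tendsto hGc ((hVc.tendsto 0).comp h.tendsto)
  have hM0 : 0 ≤ M := (norm_nonneg _).trans (hM 0 self_mem_Ici)
  have hγ1 : ∀ s, 0 ≤ s → ‖1 - γ s‖ ≤ M * s := by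
    intro s hs
    have := norm_image_sub_le_of_norm_deriv_le_segment' (f := γ) (f' := G) (a := 0) (b := s) (C := M)
      (fun r hr => (h.hasDerivAt r hr.1).hasDerivWithinAt) (fun r hr => hM r hr.1) s
      (right_mem_Icc.2 hs)
    rwa [h.zero, sub_zero, norm_sub_rev] at this
  have hQc : ContinuousOn Q (Ici 0) := fun s hs => (hQ s hs).continuousAt.continuousWithinAt
  have hQm : ∀ s, 0 ≤ s → m * s ≤ Q s := by
    intro s hs
    refine image_le_of_deriv_right_le_deriv_boundary (f := fun s => m * s) (f' := fun _ => m)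
      (B' := fun s => ‖phiNum α z (γ s)‖ ^ 2) (a := 0) (b := s)
      (by fun_prop) (fun r _ => ?_) (by simp [hQ0]) (hQc.mono fun r hr => hr.1)
      (fun r hr => (hQ r hr.1).hasDerivWithinAt) (fun r hr => hmN r hr.1) (right_mem_Icc.2 hs)
    simpa using ((hasDerivAt_id r).const_mul m).hasDerivWithinAt
  -- `1 + ε j` is the factor by which the integrands for `w j` and `z` differ
  set ε : ℕ → ℝ → ℂ := fun j s => (w j - z) * (1 - γ s) / ((1 - w j) * (1 - z * γ s)) with hε
  set B : ℕ → ℝ := fun j => ‖w j - z‖ * M / (‖1 - w j‖ * d) with hB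
  have hBlim : Tendsto B atTop (𝓝 0) := by
    have h1 : Tendsto (fun j => ‖w j - z‖ * M) atTop (𝓝 0) := by
      simpa using ((hw.sub_const z).norm).mul_const M
    have h2 : Tendsto (fun j => ‖1 - w j‖ * d) atTop (𝓝 (‖1 - z‖ * d)) :=
      ((hw.const_sub 1).norm).mul_const d
    have h3 := h1.div h2 (mul_pos (norm_pos_iff.2 hz1) hd).ne'
    rw [zero_div] at h3
    exact h3
  have hgood : ∀ᶠ j in atTop, 1 - w j ≠ 0 ∧ B j ≤ m / 2 ∧ 1 ≤ k j := by
    filter_upwards [(hw.const_sub 1).eventually_ne hz1,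
      hBlim.eventually (ge_mem_nhds (half_pos hm)), hk.tendsto_atTop.eventually_ge_atTop 1]
      with j h1 h2 h3
    exact ⟨h1, h2, h3⟩
  have hεB : ∀ j, 1 - w j ≠ 0 → ∀ s, 0 ≤ s → ‖ε j s‖ ≤ B j * s := by
    intro j hj s hs
    have hj' : 0 < ‖1 - w j‖ := norm_pos_iff.2 hj
    simp only [hε, hB, norm_div, norm_mul]
    rw [div_mul_eq_mul_div, mul_assoc ‖w j - z‖ M s]
    exact div_le_div₀ (by positivity) (by gcongr; exact hγ1 s hs) (by positivity)
      (by gcongr; exact hdγ s hs)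
  -- the integrand for `w j`, divided by `(1 - w j) ^ k j`
  set H : ℕ → ℝ → ℂ := fun j s => (Complex.exp (-(Q s : ℂ)) * (1 + ε j s)) ^ k j * G s with hH
  have hfac : ∀ j, 1 - w j ≠ 0 → ∀ s, 0 ≤ s →
      (Complex.exp (α * u s) * (1 - w j * γ s)) ^ k j * descentField α z (γ s) =
        (1 - w j) ^ k j * H j s := by
    intro j hj s hs
    have e1 : Complex.exp (α * u s) * (1 - w j * γ s) =
        (1 - w j) * (Complex.exp (-(Q s : ℂ)) * (1 + ε j s)) := by
      have hn := hne s hs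
      refine mul_right_cancel₀ hn ?_
      have e2 : (1 - w j) * (1 + ε j s) * (1 - z * γ s) = (1 - z) * (1 - w j * γ s) := by
        simp only [hε]
        field_simp
        ring
      calc _ = Complex.exp (α * u s) * (1 - z * γ s) * (1 - w j * γ s) := by ring
        _ = Complex.exp (-(Q s : ℂ)) * ((1 - z) * (1 - w j * γ s)) := by rw [hprod s hs]; ring
        _ = _ := by rw [← e2]; ring
    rw [e1, mul_pow]
    simp only [hH, hG]
    ring
  have hHle : ∀ j, 1 - w j ≠ 0 → B j ≤ m / 2 → ∀ s, 0 ≤ s →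
      ‖H j s‖ ≤ Real.exp (-(m / 2) * (k j * s)) * M := by
    intro j hj hBj s hs
    have e1 : ‖Complex.exp (-(Q s : ℂ)) * (1 + ε j s)‖ ≤ Real.exp (-(m / 2) * s) := by
      have e2 : ‖1 + ε j s‖ ≤ Real.exp (m / 2 * s) := by
        calc ‖1 + ε j s‖ ≤ 1 + ‖ε j s‖ := by simpa using norm_add_le (1 : ℂ) (ε j s)
          _ ≤ m / 2 * s + 1 := by
            have := (hεB j hj s hs).trans (mul_le_mul_of_nonneg_right hBj hs)
            linarith
          _ ≤ _ := Real.add_one_le_exp _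
      have e3 : ‖Complex.exp (-(Q s : ℂ))‖ ≤ Real.exp (-(m * s)) := by
        rw [Complex.norm_exp]
        simpa using hQm s hs
      calc _ ≤ Real.exp (-(m * s)) * Real.exp (m / 2 * s) := by
            rw [norm_mul]; gcongr
        _ = _ := by rw [← Real.exp_add]; congr 1; ring
    simp only [hH]
    rw [norm_mul, norm_pow]
    refine mul_le_mul ?_ (hM s hs) (norm_nonneg _) (Real.exp_pos _).le
    calc _ ≤ Real.exp (-(m / 2) * s) ^ k j := pow_le_pow_left₀ (norm_nonneg _) e1 _
      _ = _ := by rw [← Real.exp_nat_mul]; congr 1; ring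
  have hHc : ∀ j, 1 - w j ≠ 0 → ContinuousOn (H j) (Ici 0) := by
    intro j hj
    have e1 : ContinuousOn (ε j) (Ici 0) :=
      (continuousOn_const.mul (continuousOn_const.sub h.continuousOn)).div
        (continuousOn_const.mul hdc) fun s hs => mul_ne_zero hj (hne s hs)
    exact (((Complex.continuous_ofReal.comp_continuousOn hQc).neg.cexp.mul
      (continuousOn_const.add e1)).pow _).mul hGc
  have hHint : ∀ j, 1 - w j ≠ 0 → B j ≤ m / 2 → 1 ≤ k j → IntegrableOn (H j) (Ioi 0) := by
    intro j hj hBj hkj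
    have hb : IntegrableOn (fun s : ℝ => Real.exp (-(m / 2 * k j) * s) * M) (Ioi 0) := by
      have hpos : 0 < m / 2 * k j := by
        have : (1 : ℝ) ≤ k j := by exact_mod_cast hkj
        positivity
      exact (exp_neg_integrableOn_Ioi 0 hpos).mul_const M
    refine hb.mono' (((hHc j hj).mono Ioi_subset_Ici_self).aestronglyMeasurable
      measurableSet_Ioi) ?_
    refine (ae_restrict_iff' measurableSet_Ioi).2 (Eventually.of_forall fun s hs => ?_)
    refine (hHle j hj hBj s (le_of_lt hs)).trans_eq ?_
    congr 2
    ring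
  have hAlim : Tendsto (fun s => Complex.exp (α * u s)) atTop (𝓝 0) := by
    have e1 : Tendsto (fun s => (1 - z) * Complex.exp (-(Q s : ℂ)) / (1 - z * γ s)) atTop
        (𝓝 ((1 - z) * 0 / 1)) := by
      refine (Tendsto.const_mul _ ?_).div hdlim one_ne_zero
      refine squeeze_zero_norm' (a := fun s => Real.exp (-(m * s))) ?_ ?_
      · filter_upwards [eventually_ge_atTop 0] with s hs
        rw [Complex.norm_exp]
        simpa using hQm s hs
      · exact Real.tendsto_exp_neg_atTop_nhds_zero.comp (tendsto_id.const_mul_atTop hm)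
    simp only [mul_zero, zero_div] at e1
    refine e1.congr' ?_
    filter_upwards [eventually_ge_atTop 0] with s hs
    rw [← hprod s hs, mul_div_cancel_right₀ _ (hne s hs)]
  have hHzero : ∀ j, 1 - w j ≠ 0 → B j ≤ m / 2 → 1 ≤ k j → ∫ s in Ioi (0 : ℝ), H j s = 0 := by
    intro j hj hBj hkj
    have hcongr : ∀ s ∈ Ioi (0 : ℝ), (Complex.exp (α * u s) * (1 - w j * γ s)) ^ k j *
        descentField α z (γ s) = (1 - w j) ^ k j * H j s := fun s hs => hfac j hj s (le_of_lt hs)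
    have hHk : IntegrableOn (fun s => (1 - w j) ^ k j * H j s) (Ioi 0) :=
      (hHint j hj hBj hkj).const_mul _
    have hint := h.integral_eq hα hu0 hu hexp hAlim (k j) (w j)
      (IntegrableOn.congr_fun hHk (fun s hs => (hcongr s hs).symm) measurableSet_Ioi)
    rw [setIntegral_congr_fun measurableSet_Ioi hcongr, integral_const_mul] at hint
    have hS : binomialSum α (k j) (w j) = 0 := by
      have := hzero j
      rw [hypPoly_eq hα] at this
      exact (mul_eq_zero.1 this).resolve_left (by simpa using mul_add_ne_zero hα (k j) 0)
    rw [hS, neg_zero] at hint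
    exact (mul_eq_zero.1 hint).resolve_left (pow_ne_zero _ hj)
  have hklim : Tendsto (fun j => (k j : ℝ)) atTop atTop :=
    tendsto_natCast_atTop_atTop.comp hk.tendsto_atTop
  -- after the rescaling `s = x / k j`, dominated convergence applies
  have hmain : Tendsto (fun j => ∫ x in Ioi (0 : ℝ), H j ((k j : ℝ)⁻¹ * x)) atTop
      (𝓝 (∫ x in Ioi (0 : ℝ), (Real.exp (-c * x) : ℂ) * G 0)) := by
    refine tendsto_integral_filter_of_dominated_convergence
      (fun x => Real.exp (-(m / 2) * x) * M) ?_ ?_ ?_ ?_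
    · filter_upwards [hgood] with j hj
      have hcont : ContinuousOn (fun x : ℝ => (k j : ℝ)⁻¹ * x) (Ioi 0) := by fun_prop
      have hmaps : MapsTo (fun x : ℝ => (k j : ℝ)⁻¹ * x) (Ioi 0) (Ici 0) := fun x hx => by
        have hx0 : (0 : ℝ) < x := hx
        exact (by positivity : (0 : ℝ) ≤ (k j : ℝ)⁻¹ * x)
      exact ((hHc j hj.1).comp hcont hmaps).aestronglyMeasurable measurableSet_Ioi
    · filter_upwards [hgood] with j hj
      refine (ae_restrict_iff' measurableSet_Ioi).2 (Eventually.of_forall fun x hx => ?_)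
      have hkj : (0 : ℝ) < k j := by exact_mod_cast hj.2.2
      have hx0 : (0 : ℝ) < x := hx
      have := hHle j hj.1 hj.2.1 ((k j : ℝ)⁻¹ * x) (by positivity)
      rwa [mul_inv_cancel_left₀ hkj.ne'] at this
    · exact (exp_neg_integrableOn_Ioi 0 (half_pos hm)).mul_const M
    · refine (ae_restrict_iff' measurableSet_Ioi).2 (Eventually.of_forall fun x hx => ?_)
      have hx0 : (0 : ℝ) < x := hx
      have hs0 : Tendsto (fun j => (k j : ℝ)⁻¹ * x) atTop (𝓝 0) := by
        simpa using hklim.inv_tendsto_atTop.mul_const x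
      have hnn : ∀ j, 0 ≤ (k j : ℝ)⁻¹ * x := fun j => by positivity
      have t1 : Tendsto (fun j => G ((k j : ℝ)⁻¹ * x)) atTop (𝓝 (G 0)) :=
        (hVc.continuousAt.comp (h.continuousAt le_rfl)).tendsto.comp hs0
      have t2 : Tendsto (fun j => (k j : ℝ) * Q ((k j : ℝ)⁻¹ * x)) atTop (𝓝 (c * x)) := by
        have hQd : HasDerivAt Q c 0 := by simpa [h.zero] using hQ 0 le_rfl
        have hsl := hasDerivAt_iff_tendsto_slope_zero.1 hQd
        have hs0' : Tendsto (fun j => (k j : ℝ)⁻¹ * x) atTop (𝓝[≠] 0) := by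
          refine tendsto_nhdsWithin_iff.2 ⟨hs0, ?_⟩
          filter_upwards [hgood] with j hj
          have hkj : (0 : ℝ) < k j := by exact_mod_cast hj.2.2
          exact (by positivity : (k j : ℝ)⁻¹ * x ≠ 0)
        refine ((hsl.comp hs0').mul_const x).congr' ?_
        filter_upwards [hgood] with j hj
        have hkj : (0 : ℝ) < k j := by exact_mod_cast hj.2.2
        simp only [Function.comp_apply, zero_add, hQ0, sub_zero, smul_eq_mul]
        field_simp
      have t3 : Tendsto (fun j => Complex.exp (-(Q ((k j : ℝ)⁻¹ * x) : ℂ)) ^ k j) atTop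
          (𝓝 (Real.exp (-c * x) : ℂ)) := by
        have := (Complex.continuous_ofReal.tendsto _).comp
          ((Real.continuous_exp.tendsto _).comp t2.neg)
        rw [show -(c * x) = -c * x by ring] at this
        refine this.congr fun j => ?_
        rw [← Complex.exp_nat_mul]
        simp
      have t4 : Tendsto (fun j => (1 + ε j ((k j : ℝ)⁻¹ * x)) ^ k j) atTop (𝓝 1) := by
        rw [← tendsto_sub_nhds_zero_iff]
        have hlim : Tendsto (fun j => Real.exp (B j * x) - 1) atTop (𝓝 0) := by
          have := (Real.continuous_exp.tendsto _).comp (hBlim.mul_const x)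
          rw [zero_mul, Real.exp_zero] at this
          simpa using this.sub_const 1
        refine squeeze_zero_norm' ?_ hlim
        filter_upwards [hgood] with j hj
        have hkj : (0 : ℝ) < k j := by exact_mod_cast hj.2.2
        refine (norm_one_add_pow_sub_one_le _ _).trans (sub_le_sub_right (Real.exp_le_exp.2 ?_) 1)
        calc (k j : ℝ) * ‖ε j ((k j : ℝ)⁻¹ * x)‖ ≤ k j * (B j * ((k j : ℝ)⁻¹ * x)) := by
              gcongr; exact hεB j hj.1 _ (hnn j)
          _ = B j * x := by field_simp
      have := (t3.mul t4).mul t1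
      rw [mul_one] at this
      refine this.congr fun j => ?_
      simp only [hH, mul_pow]
  have hlimval : ∫ x in Ioi (0 : ℝ), (Real.exp (-c * x) : ℂ) * G 0 = 0 := by
    refine tendsto_nhds_unique hmain (tendsto_const_nhds.congr' ?_)
    filter_upwards [hgood] with j hj
    have hkj : (0 : ℝ) < k j := by exact_mod_cast hj.2.2
    rw [integral_comp_mul_left_Ioi (H j) 0 (inv_pos.2 hkj), mul_zero, hHzero j hj.1 hj.2.1 hj.2.2,
      smul_zero]
  have hreal : ∫ x in Ioi (0 : ℝ), (Real.exp (-c * x) : ℂ) =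
      ((∫ x in Ioi (0 : ℝ), Real.exp (-c * x) : ℝ) : ℂ) := integral_ofReal
  rw [integral_mul_const, hreal, integral_exp_mul_Ioi (neg_lt_zero.2 hc0)] at hlimval
  have := (mul_eq_zero.1 hlimval).resolve_right hG0
  rw [Complex.ofReal_eq_zero] at this
  simp [hc0.ne'] at this

end IsDescentToZero

/-- Outside the region `E`, the descending trajectory from `1` is a path from `1` to `0`. -/
theorem IsDescentFlow.isDescentToZero {α z : ℂ} {R : ℝ} {X : ℂ → ℂ} {K : ℝ≥0} {Φ : ℝ → ℂ → ℂ}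
    (h : IsDescentFlow α z R X K Φ) (hα : 0 < α.re) (hz : z ≠ 0) (hE : z ∉ regionE α) :
    IsDescentToZero α z fun s => Φ s 1 := by
  have hlim := h.tendsto_zero_of_notMem_regionE hα hz hE
  have hR : ‖(1 : ℂ)‖ ≤ R := by rw [norm_one]; exact h.one_le
  have hne : ∀ {p}, X p = 0 → p ≠ 0 → ∀ s, Φ s 1 ≠ p := by
    intro p hp hp0 s he
    have hconst : ∀ t, Φ t 1 = p := h.isFlow.eq_of_mem_equilibrium h.lipschitz hp he
    simp only [hconst] at hlim
    exact hp0 (tendsto_nhds_unique tendsto_const_nhds hlim)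
  refine ⟨h.isFlow.zero 1, fun s hs => ?_, hlim, fun s _ he => ?_, ?_⟩
  · rw [← h.eq_field _ (h.norm_le hα hR hs)]
    exact h.isFlow.hasDerivAt s 1
  · refine hne (h.field_saddlePoint hα hz) (fun h0 => ?_) s ((phiNum_eq_zero_iff hα hz).1 he)
    exact phiDen_saddlePoint_ne_zero hα hz ((phiDen_eq_zero_iff hz).2 (Or.inl h0))
  · rintro rfl
    exact hne (h.field_inv hz) (one_div_ne_zero hz) 0 (by rw [h.isFlow.zero, div_one])

/-- For `z = 0` the descending path is a logarithmic spiral. -/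
theorem isDescentToZero_zero {α : ℂ} (hα : 0 < α.re) :
    IsDescentToZero α 0 fun s : ℝ => Complex.exp (-(conj α) * s) := by
  refine ⟨by simp, fun s _ => ?_, ?_, fun s _ => ?_, zero_ne_one⟩
  · have h1 : HasDerivAt (fun s : ℝ => -(conj α) * (s : ℂ)) (-(conj α) * 1) s :=
      (Complex.ofRealCLM.hasDerivAt (x := s)).const_mul _
    convert! h1.cexp using 1
    simp [descentField, phiNum, phiDen]
    ring
  · rw [tendsto_zero_iff_norm_tendsto_zero]
    have : Tendsto (fun s : ℝ => Real.exp (-(α.re * s))) atTop (𝓝 0) :=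
      Real.tendsto_exp_neg_atTop_nhds_zero.comp (tendsto_id.const_mul_atTop hα)
    refine this.congr fun s => ?_
    rw [Complex.norm_exp]
    simp
  · simp only [phiNum, zero_mul, sub_zero]
    rintro rfl
    simp at hα

theorem mainTheorem2 (α : ℂ) (hre : 0 < α.re) (him : α.im ≠ 0) (z : ℂ) (hz : z ∉ regionE α) :
    ¬ ∃ (k : ℕ → ℕ) (w : ℕ → ℂ), StrictMono k ∧ (∀ j, hypPoly α (k j) (w j) = 0) ∧
      Tendsto w atTop (𝓝 z) := by
  rcases eq_or_ne z 0 with rfl | hz0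
  · exact (isDescentToZero_zero hre).not_tendsto_zeros hre
  · obtain ⟨R, X, K, Φ, h⟩ := exists_isDescentFlow α hz0
    exact (h.isDescentToZero hre hz0 hz).not_tendsto_zeros hre
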